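/- **Crystals.** Let $I=\{0,1,2\}$ be the index set of $G_2^{(1)}$. For crystals $B,C$ with maps $\mathrm{wt},\tilde e_i,\tilde f_i,\varepsilon_i,\varphi_i$ ($i\in I$; classical weights, i.e. weights modulo $\delta$; the symbol $0$ is adjoined to each crystal) the tensor product $B\otimes C$ is $B\times C$ with $\mathrm{wt}(b\otimes c)=\mathrm{wt}(b)+\mathrm{wt}(c)$, $\varepsilon_i(b\otimes c)=\max(\varepsilon_i(b),\varepsilon_i(c)-\langle h_i,\mathrm{wt}(b)\rangle)$, $\varphi_i(b\otimes c)=\max(\varphi_i(c),\varphi_i(b)+\langle h_i,\mathrm{wt}(c)\rangle)$, $\tilde e_i(b\otimes c)=\tilde e_ib\otimes c$ if $\varphi_i(b)\ge\varepsilon_i(c)$ and $b\otimes\tilde e_ic$ otherwise, $\tilde f_i(b\otimes c)=\tilde f_ib\otimes c$ if $\varphi_i(b)>\varepsilon_i(c)$ and $b\otimes\tilde f_ic$ otherwise. A crystal isomorphism is a bijection $B\cup\{0\}\to C\cup\{0\}$ fixing $0$, preserving $\mathrm{wt},\varepsilon_i,\varphi_i$ and all $i$-arrows. **The crystal $\mathcal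 B_l$ ($l\ge1$).** It is the set of $b=(x_1,x_2,x_3,\bar x_3,\bar x_2,\bar x_1)\in(\tfrac13\mathbb Z_{\ge0})^6$ with $3x_3\equiv3\bar x_3\pmod 2$, $s(b):=x_1+x_2+\tfrac{x_3+\bar x_3}2+\bar x_2+\bar x_1\le l$ and $x_1,\bar x_1,x_2-x_3,\bar x_3-\bar x_2\in\mathbb Z$. Put $z_1=\bar x_1-x_1$, $z_2=\bar x_2-\bar x_3$, $z_3=x_3-x_2$, $z_4=\tfrac12(\bar x_3-x_3)$, $(a)_+=\max(a,0)$, and $A=\{0,\,z_1,\,z_1+z_2,\,z_1+z_2+3z_4,\,z_1+z_2+z_3+3z_4,\,2z_1+z_2+z_3+3z_4\}$. Then $\varphi_0=l-s(b)+\max A$, $\varepsilon_0=\varphi_0-(2z_1+z_2+z_3+3z_4)$, $\varepsilon_1=\bar x_1+(\bar x_3-\bar x_2+(x_2-x_3)_+)_+$, $\varphi_1=x_1+(x_3-x_2+(\bar x_2-\bar x_3)_+)_+$, $\varepsilon_2=3\bar x_2+\tfrac32(x_3-\bar x_3)_+$, $\varphi_2=3x_2+\tfrac32(\bar x_3-x_3)_+$,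 and $\langle h_i,\mathrm{wt}(b)\rangle=\varphi_i(b)-\varepsilon_i(b)$. The operators add the following vectors to $b$ (the result is $0$ if it is not in $\mathcal B_l$). * $\tilde f_2$: $(0,-\tfrac13,\tfrac23,0,0,0)$ if $z_4\le0$; $(0,0,0,-\tfrac23,\tfrac13,0)$ if $z_4>0$. $\tilde e_2$: $(0,0,0,\tfrac23,-\tfrac13,0)$ if $z_4\ge0$; $(0,\tfrac13,-\tfrac23,0,0,0)$ if $z_4<0$. * $\tilde f_1$: $(-1,1,0,0,0,0)$ if $(z_2)_+\le-z_3$; $(0,0,-1,1,0,0)$ if $z_2\le0<z_3$; $(0,0,0,0,-1,1)$ if $z_2>(-z_3)_+$. $\tilde e_1$: $(0,0,0,0,1,-1)$ if $z_2\ge(-z_3)_+$; $(0,0,1,-1,0,0)$ if $z_2<0\le z_3$; $(1,-1,0,0,0,0)$ if $(z_2)_+<-z_3$. * $\tilde f_0$: $(1,0,0,0,0,0)$ if $(F_1)$; $(0,0,1,1,0,-1)$ if $(F_2)$; $(0,0,2,0,-1,0)$ if $(F_3)$; if $(F_4)$: $(0,\tfrac13,\tfrac43,-\tfrac23,-\tfrac23,0)$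 when $z_4=\tfrac13$, $(0,\tfrac23,\tfrac23,-\tfrac43,-\tfrac13,0)$ when $z_4=\tfrac23$, and $(0,1,0,-2,0,0)$ otherwise; $(1,0,-1,-1,0,0)$ if $(F_5)$; $(0,0,0,0,0,-1)$ if $(F_6)$. * $\tilde e_0$: $(-1,0,0,0,0,0)$ if $(E_1)$; $(0,0,-1,-1,0,1)$ if $(E_2)$; if $(E_3)$: $(0,-\tfrac23,-\tfrac23,\tfrac43,\tfrac13,0)$ when $z_4=-\tfrac13$, $(0,-\tfrac13,-\tfrac43,\tfrac23,\tfrac23,0)$ when $z_4=-\tfrac23$, and $(0,0,-2,0,1,0)$ otherwise; $(0,-1,0,2,0,0)$ if $(E_4)$; $(-1,0,1,1,0,0)$ if $(E_5)$; $(0,0,0,0,0,1)$ if $(E_6)$. Here exactly one of the following conditions holds: $(F_1)$ $z_1+z_2+z_3+3z_4\le0,\ z_1+z_2+3z_4\le0,\ z_1+z_2\le0,\ z_1\le0$; $(F_2)$ $z_1+z_2+z_3+3z_4\le0,\ z_2+3z_4\le0,\ z_2\le0,\ z_1>0$; $(F_3)$ $z_1+z_3+3z_4\le0,\ z_3+3z_4\le0,\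 z_4\le0,\ z_2>0,\ z_1+z_2>0$; $(F_4)$ $z_1+z_2+3z_4>0,\ z_2+3z_4>0,\ z_4>0,\ z_3\le0,\ z_1+z_3\le0$; $(F_5)$ $z_1+z_2+z_3+3z_4>0,\ z_3+3z_4>0,\ z_3>0,\ z_1\le0$; $(F_6)$ $z_1+z_2+z_3+3z_4>0,\ z_1+z_3+3z_4>0,\ z_1+z_3>0,\ z_1>0$; and $(E_i)$ is $(F_i)$ with $>$ replaced by $\ge$ and $\le$ replaced by $<$. **Energy function.** Let $\mathcal R:\mathcal B_l\otimes\mathcal B_1\to\mathcal B_1\otimes\mathcal B_l$ be the crystal isomorphism, and write $\mathcal R(b\otimes b')=\tilde b'\otimes\tilde b$. An energy function is a map $H:\mathcal B_l\otimes\mathcal B_1\to\mathbb Z$ such that, whenever $\tilde e_i(b\otimes b')\neq0$, $H(\tilde e_i(b\otimes b'))-H(b\otimes b')$ equals $1$ if $i=0$, $\varphi_0(b)\ge\varepsilon_0(b')$ and $\varphi_0(\tilde b')\ge\varepsilon_0(\tilde b)$; equals $-1$ if $i=0$, $\varphi_0(b)<\varepsilon_0(b')$ and $\varphi_0(\tilde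 b')<\varepsilon_0(\tilde b)$; and equals $0$ otherwise. **Theorem.** Let $l\ge1$ and let $H$ be the energy function on $\mathcal B_l\otimes\mathcal B_1$ normalized by $H((l,0,0,0,0,0)\otimes(1,0,0,0,0,0))=0$. Every highest weight vector of $\mathcal B_l\otimes\mathcal B_1$ (an element killed by $\tilde e_1$ and $\tilde e_2$) has the form $(j,0,0,0,0,0)\otimes b'$ with an integer $0\le j\le l$ and $b'\in\mathcal B_1$, and $$H((j,0,0,0,0,0)\otimes b')=\begin{cases}0&\text{if } j=l,\ b'=(1,0,0,0,0,0),\\ -1&\text{if } j=l-1,\ b'=(1,0,0,0,0,0),\\ -1&\text{if } j=l \text{ and } b'=(0,1,0,0,0,0)\text{ or }(0,0,0,0,0,0),\\ -2&\text{otherwise.}\end{cases}$$ -/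

import Mathlib

/-! Crystals over the index set `I = {0, 1, 2}` of `G₂⁽¹⁾`, the crystals `B_l`, their tensor
products, crystal isomorphisms and energy functions. -/

namespace G2Crystal

/-- The data of a `U_q'(𝔤)`-crystal with index set `I = {0, 1, 2}`. The value `none` is the
element `0` adjoined to the crystal. A (classical) weight `∑ m_i Λ_i` is represented by its
coefficients `i ↦ m_i = ⟨h_i, wt⟩`. -/
structure CrystalData where
  carrier : Type
  wt : carrier → Fin 3 → ℤ
  e : Fin 3 → carrier → Option carrier
  f : Fin 3 → carrier → Option carrier
  eps : Fin 3 → carrier → ℤ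
  phi : Fin 3 → carrier → ℤ

/-- The tensor product of crystals; the pair `(b₁, b₂)` is `b₁ ⊗ b₂`. -/
def CrystalData.tensor (B C : CrystalData) : CrystalData where
  carrier := B.carrier × C.carrier
  wt b i := B.wt b.1 i + C.wt b.2 i
  e i b :=
    if C.eps i b.2 ≤ B.phi i b.1 then (B.e i b.1).map (fun b₁ => (b₁, b.2))
    else (C.e i b.2).map (fun b₂ => (b.1, b₂))
  f i b :=
    if C.eps i b.2 < B.phi i b.1 then (B.f i b.1).map (fun b₁ => (b₁, b.2))
    else (C.f i b.2).map (fun b₂ => (b.1, b₂))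
  eps i b := max (B.eps i b.1) (C.eps i b.2 - B.wt b.1 i)
  phi i b := max (C.phi i b.2) (B.phi i b.1 + C.wt b.2 i)

/-- `Ψ : B ∪ {0} → C ∪ {0}` is a crystal isomorphism. -/
structure IsCrystalIso (B C : CrystalData)
    (Ψ : Option B.carrier → Option C.carrier) : Prop where
  bijective : Function.Bijective Ψ
  map_zero : Ψ none = none
  map_wt : ∀ b c, Ψ (some b) = some c → C.wt c = B.wt b
  map_eps : ∀ b c, Ψ (some b) = some c → ∀ i, C.eps i c = B.eps i b
  map_phi : ∀ b c, Ψ (some b) = some c → ∀ i, C.phi i c = B.phi i b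
  map_arrow : ∀ b b' c c', Ψ (some b) = some c → Ψ (some b') = some c' →
    ∀ i, B.f i b = some b' → C.f i c = some c' ∧ C.e i c' = some c

/-- `H : B ⊗ C → ℤ` is an energy function: there is a crystal isomorphism
`R : B ⊗ C → C ⊗ B` (the combinatorial `R` matrix) such that, whenever `ẽ_i (b ⊗ b') ≠ 0` and
`R (b ⊗ b') = c' ⊗ c`, the value `H (ẽ_i (b ⊗ b'))` is given by the rule below. -/
def IsEnergyFunction (B C : CrystalData) (H : (B.tensor C).carrier → ℤ) : Prop :=
  ∃ R : Option (B.tensor C).carrier → Option (C.tensor B).carrier,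
    IsCrystalIso (B.tensor C) (C.tensor B) R ∧
    ∀ (i : Fin 3) (b : B.carrier) (b' : C.carrier) (c' : C.carrier) (c : B.carrier)
      (x : (B.tensor C).carrier),
      (B.tensor C).e i (b, b') = some x → R (some (b, b')) = some (c', c) →
      H x =
        if i = 0 ∧ B.phi 0 b ≥ C.eps 0 b' ∧ C.phi 0 c' ≥ B.eps 0 c then H (b, b') + 1
        else if i = 0 ∧ B.phi 0 b < C.eps 0 b' ∧ C.phi 0 c' < B.eps 0 c then H (b, b') - 1
        else H (b, b')

/-- A highest weight vector for the subalgebra `U_q(G₂)`, that is for the indices `1, 2`. -/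
def IsHighestWeight (B : CrystalData) (b : B.carrier) : Prop :=
  B.e 1 b = none ∧ B.e 2 b = none

/-- Coordinates `(x₁, x₂, x₃, x̄₃, x̄₂, x̄₁)`; the barred ones are written `y`. -/
@[ext] structure Coords where
  x₁ : ℚ
  x₂ : ℚ
  x₃ : ℚ
  y₃ : ℚ
  y₂ : ℚ
  y₁ : ℚ

namespace Coords

def add (b d : Coords) : Coords :=
  ⟨b.x₁ + d.x₁, b.x₂ + d.x₂, b.x₃ + d.x₃, b.y₃ + d.y₃, b.y₂ + d.y₂, b.y₁ + d.y₁⟩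

def s (b : Coords) : ℚ := b.x₁ + b.x₂ + (b.x₃ + b.y₃) / 2 + b.y₂ + b.y₁

def z₁ (b : Coords) : ℚ := b.y₁ - b.x₁
def z₂ (b : Coords) : ℚ := b.y₂ - b.y₃
def z₃ (b : Coords) : ℚ := b.x₃ - b.x₂
def z₄ (b : Coords) : ℚ := (b.y₃ - b.x₃) / 2

/-- The maximum of the set `A`. -/
def maxA (b : Coords) : ℚ :=
  max 0 (max b.z₁ (max (b.z₁ + b.z₂) (max (b.z₁ + b.z₂ + 3 * b.z₄)
    (max (b.z₁ + b.z₂ + b.z₃ + 3 * b.z₄) (2 * b.z₁ + b.z₂ + b.z₃ + 3 * b.z₄)))))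

/-- The condition `b ∈ B_l`. -/
structure Mem (l : ℕ) (b : Coords) : Prop where
  x₁_third : ∃ n : ℕ, 3 * b.x₁ = n
  x₂_third : ∃ n : ℕ, 3 * b.x₂ = n
  x₃_third : ∃ n : ℕ, 3 * b.x₃ = n
  y₃_third : ∃ n : ℕ, 3 * b.y₃ = n
  y₂_third : ∃ n : ℕ, 3 * b.y₂ = n
  y₁_third : ∃ n : ℕ, 3 * b.y₁ = n
  parity : ∃ n : ℤ, 3 * b.x₃ - 3 * b.y₃ = 2 * n
  s_le : b.s ≤ l
  x₁_int : ∃ n : ℤ, b.x₁ = n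
  y₁_int : ∃ n : ℤ, b.y₁ = n
  x₂_sub_x₃_int : ∃ n : ℤ, b.x₂ - b.x₃ = n
  y₃_sub_y₂_int : ∃ n : ℤ, b.y₃ - b.y₂ = n

def F₁ (b : Coords) : Prop :=
  b.z₁ + b.z₂ + b.z₃ + 3 * b.z₄ ≤ 0 ∧ b.z₁ + b.z₂ + 3 * b.z₄ ≤ 0 ∧ b.z₁ + b.z₂ ≤ 0 ∧ b.z₁ ≤ 0
def F₂ (b : Coords) : Prop :=
  b.z₁ + b.z₂ + b.z₃ + 3 * b.z₄ ≤ 0 ∧ b.z₂ + 3 * b.z₄ ≤ 0 ∧ b.z₂ ≤ 0 ∧ 0 < b.z₁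
def F₃ (b : Coords) : Prop :=
  b.z₁ + b.z₃ + 3 * b.z₄ ≤ 0 ∧ b.z₃ + 3 * b.z₄ ≤ 0 ∧ b.z₄ ≤ 0 ∧ 0 < b.z₂ ∧ 0 < b.z₁ + b.z₂
def F₄ (b : Coords) : Prop :=
  0 < b.z₁ + b.z₂ + 3 * b.z₄ ∧ 0 < b.z₂ + 3 * b.z₄ ∧ 0 < b.z₄ ∧ b.z₃ ≤ 0 ∧ b.z₁ + b.z₃ ≤ 0
def F₅ (b : Coords) : Prop :=
  0 < b.z₁ + b.z₂ + b.z₃ + 3 * b.z₄ ∧ 0 < b.z₃ + 3 * b.z₄ ∧ 0 < b.z₃ ∧ b.z₁ ≤ 0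
def F₆ (b : Coords) : Prop :=
  0 < b.z₁ + b.z₂ + b.z₃ + 3 * b.z₄ ∧ 0 < b.z₁ + b.z₃ + 3 * b.z₄ ∧ 0 < b.z₁ + b.z₃ ∧ 0 < b.z₁

def E₁ (b : Coords) : Prop :=
  b.z₁ + b.z₂ + b.z₃ + 3 * b.z₄ < 0 ∧ b.z₁ + b.z₂ + 3 * b.z₄ < 0 ∧ b.z₁ + b.z₂ < 0 ∧ b.z₁ < 0
def E₂ (b : Coords) : Prop :=
  b.z₁ + b.z₂ + b.z₃ + 3 * b.z₄ < 0 ∧ b.z₂ + 3 * b.z₄ < 0 ∧ b.z₂ < 0 ∧ 0 ≤ b.z₁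
def E₃ (b : Coords) : Prop :=
  b.z₁ + b.z₃ + 3 * b.z₄ < 0 ∧ b.z₃ + 3 * b.z₄ < 0 ∧ b.z₄ < 0 ∧ 0 ≤ b.z₂ ∧ 0 ≤ b.z₁ + b.z₂
def E₄ (b : Coords) : Prop :=
  0 ≤ b.z₁ + b.z₂ + 3 * b.z₄ ∧ 0 ≤ b.z₂ + 3 * b.z₄ ∧ 0 ≤ b.z₄ ∧ b.z₃ < 0 ∧ b.z₁ + b.z₃ < 0
def E₅ (b : Coords) : Prop :=
  0 ≤ b.z₁ + b.z₂ + b.z₃ + 3 * b.z₄ ∧ 0 ≤ b.z₃ + 3 * b.z₄ ∧ 0 ≤ b.z₃ ∧ b.z₁ < 0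
def E₆ (b : Coords) : Prop :=
  0 ≤ b.z₁ + b.z₂ + b.z₃ + 3 * b.z₄ ∧ 0 ≤ b.z₁ + b.z₃ + 3 * b.z₄ ∧ 0 ≤ b.z₁ + b.z₃ ∧ 0 ≤ b.z₁

/-- The six conditions `(E_i)` are exhaustive. -/
theorem E_cases (b : Coords) : E₁ b ∨ E₂ b ∨ E₃ b ∨ E₄ b ∨ E₅ b ∨ E₆ b := by
  simp only [E₁, E₂, E₃, E₄, E₅, E₆]
  grind (splits := 40)

/-- The six conditions `(F_i)` are exhaustive. -/
theorem F_cases (b : Coords) : F₁ b ∨ F₂ b ∨ F₃ b ∨ F₄ b ∨ F₅ b ∨ F₆ b := by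
  simp only [F₁, F₂, F₃, F₄, F₅, F₆]
  grind (splits := 40)

open Classical in
/-- `ẽ_0` in coordinates. By `E_cases` the last branch is never reached. -/
noncomputable def e₀ (b : Coords) : Coords :=
  if E₁ b then b.add ⟨-1, 0, 0, 0, 0, 0⟩
  else if E₂ b then b.add ⟨0, 0, -1, -1, 0, 1⟩
  else if E₃ b then
    if b.z₄ = -1/3 then b.add ⟨0, -2/3, -2/3, 4/3, 1/3, 0⟩
    else if b.z₄ = -2/3 then b.add ⟨0, -1/3, -4/3, 2/3, 2/3, 0⟩
    else b.add ⟨0, 0, -2, 0, 1, 0⟩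
  else if E₄ b then b.add ⟨0, -1, 0, 2, 0, 0⟩
  else if E₅ b then b.add ⟨-1, 0, 1, 1, 0, 0⟩
  else if E₆ b then b.add ⟨0, 0, 0, 0, 0, 1⟩
  else b

open Classical in
/-- `f̃_0` in coordinates. By `F_cases` the last branch is never reached. -/
noncomputable def f₀ (b : Coords) : Coords :=
  if F₁ b then b.add ⟨1, 0, 0, 0, 0, 0⟩
  else if F₂ b then b.add ⟨0, 0, 1, 1, 0, -1⟩
  else if F₃ b then b.add ⟨0, 0, 2, 0, -1, 0⟩
  else if F₄ b then
    if b.z₄ = 1/3 then b.add ⟨0, 1/3, 4/3, -2/3, -2/3, 0⟩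
    else if b.z₄ = 2/3 then b.add ⟨0, 2/3, 2/3, -4/3, -1/3, 0⟩
    else b.add ⟨0, 1, 0, -2, 0, 0⟩
  else if F₅ b then b.add ⟨1, 0, -1, -1, 0, 0⟩
  else if F₆ b then b.add ⟨0, 0, 0, 0, 0, -1⟩
  else b

/-- `ẽ_1` in coordinates. The last branch is the case `(z₂)₊ < -z₃`. -/
def e₁ (b : Coords) : Coords :=
  if max (-b.z₃) 0 ≤ b.z₂ then b.add ⟨0, 0, 0, 0, 1, -1⟩
  else if b.z₂ < 0 ∧ 0 ≤ b.z₃ then b.add ⟨0, 0, 1, -1, 0, 0⟩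
  else b.add ⟨1, -1, 0, 0, 0, 0⟩

/-- `f̃_1` in coordinates. The last branch is the case `z₂ > (-z₃)₊`. -/
def f₁ (b : Coords) : Coords :=
  if max b.z₂ 0 ≤ -b.z₃ then b.add ⟨-1, 1, 0, 0, 0, 0⟩
  else if b.z₂ ≤ 0 ∧ 0 < b.z₃ then b.add ⟨0, 0, -1, 1, 0, 0⟩
  else b.add ⟨0, 0, 0, 0, -1, 1⟩

/-- `ẽ_2` in coordinates. -/
def e₂ (b : Coords) : Coords :=
  if 0 ≤ b.z₄ then b.add ⟨0, 0, 0, 2/3, -1/3, 0⟩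
  else b.add ⟨0, 1/3, -2/3, 0, 0, 0⟩

/-- `f̃_2` in coordinates. -/
def f₂ (b : Coords) : Coords :=
  if b.z₄ ≤ 0 then b.add ⟨0, -1/3, 2/3, 0, 0, 0⟩
  else b.add ⟨0, 0, 0, -2/3, 1/3, 0⟩

noncomputable def e (i : Fin 3) (b : Coords) : Coords := ![e₀ b, e₁ b, e₂ b] i
noncomputable def f (i : Fin 3) (b : Coords) : Coords := ![f₀ b, f₁ b, f₂ b] i

/-- The formulas for `ε_i` on `B_l`. -/
def epsQ (l : ℕ) (i : Fin 3) (b : Coords) : ℚ :=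
  ![l - b.s + b.maxA - (2 * b.z₁ + b.z₂ + b.z₃ + 3 * b.z₄),
    b.y₁ + max (b.y₃ - b.y₂ + max (b.x₂ - b.x₃) 0) 0,
    3 * b.y₂ + 3 / 2 * max (b.x₃ - b.y₃) 0] i

/-- The formulas for `φ_i` on `B_l`. -/
def phiQ (l : ℕ) (i : Fin 3) (b : Coords) : ℚ :=
  ![l - b.s + b.maxA,
    b.x₁ + max (b.x₃ - b.x₂ + max (b.y₂ - b.y₃) 0) 0,
    3 * b.x₂ + 3 / 2 * max (b.y₃ - b.x₃) 0] i

end Coords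

/-- The set `B_l`. -/
def BSet (l : ℕ) : Type := {b : Coords // Coords.Mem l b}

open Classical in
/-- `B_l` as a crystal: `ẽ_i b` and `f̃_i b` are `0` when the coordinate formula leaves `B_l`.
The rational numbers `epsQ` and `phiQ` are integers on `B_l` (`B_eps_cast`, `B_phi_cast`), so
taking the floor only changes their type; `⟨h_i, wt b⟩ = φ_i b - ε_i b`. -/
noncomputable def B (l : ℕ) : CrystalData where
  carrier := BSet l
  wt b i := ⌊Coords.phiQ l i b.1⌋ - ⌊Coords.epsQ l i b.1⌋
  e i b := if h : Coords.Mem l (Coords.e i b.1) then some ⟨Coords.e i b.1, h⟩ else none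
  f i b := if h : Coords.Mem l (Coords.f i b.1) then some ⟨Coords.f i b.1, h⟩ else none
  eps i b := ⌊Coords.epsQ l i b.1⌋
  phi i b := ⌊Coords.phiQ l i b.1⌋

theorem B_int_aux {l : ℕ} {b : Coords} (hb : Coords.Mem l b) :
    (∃ n : ℤ, b.x₁ = n) ∧ (∃ n : ℤ, b.y₁ = n) ∧ (∃ n : ℤ, b.z₂ = n) ∧ (∃ n : ℤ, b.z₃ = n) ∧
    (∃ n : ℤ, 3 * b.z₄ = n) ∧ (∃ n : ℤ, b.s = n) := by
  obtain ⟨-, ⟨a2, h2⟩, ⟨a3, h3⟩, ⟨c3, k3⟩, ⟨c2, k2⟩, -, ⟨p, hp⟩, -, ⟨a1, h1⟩, ⟨c1, k1⟩,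
    ⟨q, hq⟩, ⟨r, hr⟩⟩ := hb
  refine ⟨⟨a1, h1⟩, ⟨c1, k1⟩, ⟨-r, ?_⟩, ⟨-q, ?_⟩, ⟨-p, ?_⟩, ⟨a1 + q + c3 + p - r + c1, ?_⟩⟩ <;>
    simp only [Coords.z₂, Coords.z₃, Coords.z₄, Coords.s] <;> push_cast <;> linarith

theorem B_eps_cast {l : ℕ} (i : Fin 3) (b : (B l).carrier) :
    (((B l).eps i b : ℤ) : ℚ) = Coords.epsQ l i b.1 := by
  suffices h : ∃ n : ℤ, Coords.epsQ l i b.1 = n by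
    obtain ⟨n, h⟩ := h
    simp [B, h]
  obtain ⟨⟨n1, h1⟩, ⟨m1, k1⟩, ⟨n2, h2⟩, ⟨n3, h3⟩, ⟨n4, h4⟩, ⟨n5, h5⟩⟩ := B_int_aux b.2
  obtain ⟨c2, k2⟩ := b.2.y₂_third
  have e1 : b.1.y₃ - b.1.y₂ = ((-n2 : ℤ) : ℚ) := by
    push_cast; rw [← h2, Coords.z₂]; ring
  have e2 : b.1.x₂ - b.1.x₃ = ((-n3 : ℤ) : ℚ) := by
    push_cast; rw [← h3, Coords.z₃]; ring
  have e3 : 3 / 2 * max (b.1.x₃ - b.1.y₃) 0 = ((max (-n4) 0 : ℤ) : ℚ) := by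
    push_cast; rw [← h4, Coords.z₄, mul_max_of_nonneg _ _ (by norm_num)]; ring_nf
  have e4 : b.1.z₁ = ((m1 - n1 : ℤ) : ℚ) := by
    push_cast; rw [← h1, ← k1, Coords.z₁]
  fin_cases i
  · exact ⟨l - n5 + max 0 (max (m1 - n1) (max (m1 - n1 + n2) (max (m1 - n1 + n2 + n4)
      (max (m1 - n1 + n2 + n3 + n4) (2 * (m1 - n1) + n2 + n3 + n4))))) -
      (2 * (m1 - n1) + n2 + n3 + n4), by
        simp only [Coords.epsQ, Coords.maxA, h2, h3, h4, h5, e4]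
        push_cast
        rfl⟩
  · exact ⟨m1 + max (-n2 + max (-n3) 0) 0, by simp [Coords.epsQ, e1, e2, k1]⟩
  · exact ⟨c2 + max (-n4) 0, by simp [Coords.epsQ, e3, k2]⟩

theorem B_phi_cast {l : ℕ} (i : Fin 3) (b : (B l).carrier) :
    (((B l).phi i b : ℤ) : ℚ) = Coords.phiQ l i b.1 := by
  suffices h : ∃ n : ℤ, Coords.phiQ l i b.1 = n by
    obtain ⟨n, h⟩ := h
    simp [B, h]
  obtain ⟨⟨n1, h1⟩, ⟨m1, k1⟩, ⟨n2, h2⟩, ⟨n3, h3⟩, ⟨n4, h4⟩, ⟨n5, h5⟩⟩ := B_int_aux b.2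
  obtain ⟨c2, k2⟩ := b.2.x₂_third
  have e1 : b.1.y₂ - b.1.y₃ = (n2 : ℚ) := h2
  have e2 : b.1.x₃ - b.1.x₂ = (n3 : ℚ) := h3
  have e3 : 3 / 2 * max (b.1.y₃ - b.1.x₃) 0 = ((max n4 0 : ℤ) : ℚ) := by
    push_cast; rw [← h4, Coords.z₄, mul_max_of_nonneg _ _ (by norm_num)]; ring_nf
  have e4 : b.1.z₁ = ((m1 - n1 : ℤ) : ℚ) := by
    push_cast; rw [← h1, ← k1, Coords.z₁]
  fin_cases i
  · exact ⟨l - n5 + max 0 (max (m1 - n1) (max (m1 - n1 + n2) (max (m1 - n1 + n2 + n4)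
      (max (m1 - n1 + n2 + n3 + n4) (2 * (m1 - n1) + n2 + n3 + n4))))), by
        simp only [Coords.phiQ, Coords.maxA, h2, h3, h4, h5, e4]
        push_cast
        rfl⟩
  · exact ⟨n1 + max (n3 + max n2 0) 0, by simp [Coords.phiQ, e1, e2, h1]⟩
  · exact ⟨c2 + max n4 0, by simp [Coords.phiQ, e3, k2]⟩

/-- The element `(j, 0, 0, 0, 0, 0)` of `B_l`, for `0 ≤ j ≤ l`. -/
def u {l : ℕ} (j : ℕ) (hj : j ≤ l) : (B l).carrier :=
  ⟨⟨j, 0, 0, 0, 0, 0⟩, by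
    constructor
    · exact ⟨3 * j, by push_cast; ring⟩
    iterate 5 exact ⟨0, by norm_num⟩
    · exact ⟨0, by norm_num⟩
    · simpa [Coords.s] using hj
    · exact ⟨j, by simp⟩
    iterate 3 exact ⟨0, by norm_num⟩⟩

end G2Crystal

/-!
An energy function is determined along the arrows of `B_l ⊗ B_1` once the image under `R` is known
at one vertex: an arrow `x → x'` is carried by `R` to an arrow of `B_1 ⊗ B_l`, and the energy
changes only along arrows of colour 0, by an amount read off from the factors on which the operator
acts before and after applying `R` (`Link.f`, `Link.e`). So each highest weight vector is joined to
`u_l ⊗ u_1`, where `u_j = (j, 0, 0, 0, 0, 0)`, by an explicit path. The image of `u_l ⊗ u_1` is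
`u_1 ⊗ u_l`, because no other vector has the same weight for `h₀` (`IsEnergyPair.link_top`).

Let `axis m` be `u_m` for `m ≥ 0` and `(0, 0, 0, 0, 0, -m)` for `m ≤ 0`; these elements form a
`0`-string, and `axis 0` is written `0` below. Applying `ẽ_0` to `u_l ⊗ u_1` repeatedly gives
`u_l ⊗ 0` with energy `-1`, then all `axis m ⊗ axis (-1)` with `2 - l ≤ m ≤ l`, which have energy
`-2` and image `u_1 ⊗ axis (m - 2)`, and finally `axis (1 - l) ⊗ axis (-1)`, which has energy `-1`
and image `0 ⊗ axis (-l)`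
(`IsEnergyPair.link_zero`, `IsEnergyPair.link_neg`, `IsEnergyPair.link_bottom`). The remaining
highest weight vectors are reached from these.

* The vector `axis (1 - l) ⊗ axis (-1)` is the lowest weight vector of a classical component, and
  raising it along extremal strings leads to `u_{l-1} ⊗ u_1`, with image `0 ⊗ u_l` and energy `-1`
  (`IsEnergyPair.link_one`). From there `ẽ_0` leads to `u_j ⊗ 0` for all `j < l`, with energy `-2`
  (`IsEnergyPair.link_axis_zero`).
* In `0 ⊗ axis (-1)` the classical operators act on the right factor only, and lead to `0 ⊗ b'` for
  all highest weight factors `b' ≠ 0` (`IsEnergyPair.linkedAtZero`). Then `f̃_0` raises the left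
  factor to `u_j`; this does not change the energy once the first factor of the image is `u_1`,
  since `φ_0 (u_1) = 0` (`Link.f_zero`, `LinkedAtZero.raise`). At `j = l` one further `f̃_0` leads
  from `u_l ⊗ (0, 0, 0, 2, 0, 0)` to `u_l ⊗ (0, 1, 0, 0, 0, 0)` and raises the energy to `-1`.

That there are no other highest weight vectors follows from the signature rule
(`highestWeight_cases`).
-/

namespace G2Crystal

open Coords

/-! ### Integral coordinates and classical arrows -/

/-- The element with coordinates `(p, a/3, b/3, c/3, d/3, q)`. Every element of `B_l` is of this
form for integers `p, a, b, c, d, q`, in which membership is linear arithmetic. -/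
def thirds (p a b c d q : ℤ) : Coords := ⟨p, a / 3, b / 3, c / 3, d / 3, q⟩

theorem mem_thirds {l : ℕ} {p a b c d q : ℤ} (hp : 0 ≤ p) (ha : 0 ≤ a) (hb : 0 ≤ b) (hc : 0 ≤ c)
    (hd : 0 ≤ d) (hq : 0 ≤ q) (hab : (3 : ℤ) ∣ a - b) (hcd : (3 : ℤ) ∣ c - d)
    (hbc : (2 : ℤ) ∣ b - c) (hs : 6 * p + 2 * a + b + c + 2 * d + 6 * q ≤ 6 * l) :
    Mem l (thirds p a b c d q) := by
  have nat_of_nonneg : ∀ {x : ℤ}, 0 ≤ x → ∃ n : ℕ, (x : ℚ) = n := fun {x} hx =>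
    ⟨x.toNat, by exact_mod_cast (Int.toNat_of_nonneg hx).symm⟩
  obtain ⟨r, hr⟩ := hab
  obtain ⟨t, ht⟩ := hcd
  obtain ⟨v, hv⟩ := hbc
  have hrQ : (a : ℚ) - b = 3 * r := by exact_mod_cast hr
  have htQ : (c : ℚ) - d = 3 * t := by exact_mod_cast ht
  have hvQ : (b : ℚ) - c = 2 * v := by exact_mod_cast hv
  have hsQ : 6 * (p : ℚ) + 2 * a + b + c + 2 * d + 6 * q ≤ 6 * l := by exact_mod_cast hs
  obtain ⟨p', hp'⟩ := nat_of_nonneg hp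
  obtain ⟨q', hq'⟩ := nat_of_nonneg hq
  obtain ⟨a', ha'⟩ := nat_of_nonneg ha
  obtain ⟨b', hb'⟩ := nat_of_nonneg hb
  obtain ⟨c', hc'⟩ := nat_of_nonneg hc
  obtain ⟨d', hd'⟩ := nat_of_nonneg hd
  constructor
  · exact ⟨3 * p', by simp only [thirds]; push_cast; linarith⟩
  · exact ⟨a', by simp only [thirds]; linarith⟩
  · exact ⟨b', by simp only [thirds]; linarith⟩
  · exact ⟨c', by simp only [thirds]; linarith⟩
  · exact ⟨d', by simp only [thirds]; linarith⟩
  · exact ⟨3 * q', by simp only [thirds]; push_cast; linarith⟩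
  · exact ⟨v, by simp only [thirds]; linarith⟩
  · simp only [thirds, s]; linarith
  · exact ⟨p, rfl⟩
  · exact ⟨q, rfl⟩
  · exact ⟨r, by simp only [thirds]; linarith⟩
  · exact ⟨t, by simp only [thirds]; linarith⟩

theorem exists_thirds {l : ℕ} {x : Coords} (hx : Mem l x) :
    ∃ p a b c d q : ℤ, x = thirds p a b c d q ∧ 0 ≤ p ∧ 0 ≤ a ∧ 0 ≤ b ∧ 0 ≤ c ∧ 0 ≤ d ∧ 0 ≤ q ∧
      (3 : ℤ) ∣ a - b ∧ (3 : ℤ) ∣ c - d ∧ (2 : ℤ) ∣ b - c ∧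
      6 * p + 2 * a + b + c + 2 * d + 6 * q ≤ 6 * l := by
  obtain ⟨⟨a1, h1⟩, ⟨a2, h2⟩, ⟨a3, h3⟩, ⟨c3, k3⟩, ⟨c2, k2⟩, ⟨c1, k1⟩, ⟨v, hv⟩, hs, ⟨p, hp⟩,
    ⟨q, hq⟩, ⟨r, hr⟩, ⟨t, ht⟩⟩ := hx
  refine ⟨p, a2, a3, c3, c2, q, ?_, ?_, by positivity, by positivity, by positivity,
    by positivity, ?_, ⟨r, ?_⟩, ⟨t, ?_⟩, ⟨v, ?_⟩, ?_⟩
  · ext <;> simp only [thirds, Int.cast_natCast] <;> linarith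
  · have h : (0 : ℚ) ≤ p := by have : (0 : ℚ) ≤ a1 := by positivity
                               linarith
    exact_mod_cast h
  · have h : (0 : ℚ) ≤ q := by have : (0 : ℚ) ≤ c1 := by positivity
                               linarith
    exact_mod_cast h
  · have h : (a2 : ℚ) - a3 = 3 * r := by linarith
    exact_mod_cast h
  · have h : (c3 : ℚ) - c2 = 3 * t := by linarith
    exact_mod_cast h
  · have h : (a3 : ℚ) - c3 = 2 * v := by linarith
    exact_mod_cast h
  · have h : 6 * (p : ℚ) + 2 * a2 + a3 + c3 + 2 * c2 + 6 * q ≤ 6 * l := by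
      simp only [s] at hs
      linarith
    exact_mod_cast h

/-- An arrow `b → f̃_i b = b'` of `B_l`, together with the facts that `ẽ_i` inverts it and that
`φ_i` drops and `ε_i` grows by one along it. -/
structure Arrow (l : ℕ) (i : Fin 3) (b b' : Coords) : Prop where
  mem_source : Mem l b
  mem_target : Mem l b'
  f_eq : Coords.f i b = b'
  e_eq : Coords.e i b' = b
  phi_target : phiQ l i b' = phiQ l i b - 1
  eps_target : epsQ l i b' = epsQ l i b + 1

section ClassicalArrows

variable {l : ℕ} {p a b c d q : ℤ}

theorem arrow_two_left (h : Mem l (thirds p a b c d q))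
    (h' : Mem l (thirds p (a - 1) (b + 2) c d q))
    (hcb : c ≤ b) : Arrow l 2 (thirds p a b c d q) (thirds p (a - 1) (b + 2) c d q) := by
  have hcb : (c : ℚ) ≤ b := by exact_mod_cast hcb
  refine ⟨h, h', ?_, ?_, ?_, ?_⟩
  · have : z₄ (thirds p a b c d q) ≤ 0 := by simp only [z₄, thirds]; linarith
    simp only [Coords.f, Matrix.cons_val, f₂, if_pos this]
    ext <;> simp only [Coords.add, thirds] <;> push_cast <;> ring
  · have : ¬ 0 ≤ z₄ (thirds p (a - 1) (b + 2) c d q) := by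
      simp only [z₄, thirds]; push_cast; linarith
    simp only [Coords.e, Matrix.cons_val, e₂, if_neg this]
    ext <;> simp only [Coords.add, thirds] <;> push_cast <;> ring
  · simp only [phiQ, Matrix.cons_val, thirds]
    push_cast
    rw [max_eq_right (by linarith), max_eq_right (by linarith)]; ring
  · simp only [epsQ, Matrix.cons_val, thirds]
    push_cast
    rw [max_eq_left (by linarith), max_eq_left (by linarith)]; ring

theorem arrow_two_right (h : Mem l (thirds p a b c d q))
    (h' : Mem l (thirds p a b (c - 2) (d + 1) q)) (hbc : b + 2 ≤ c) :
    Arrow l 2 (thirds p a b c d q) (thirds p a b (c - 2) (d + 1) q) := by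
  have hbc : (b : ℚ) + 2 ≤ c := by exact_mod_cast hbc
  refine ⟨h, h', ?_, ?_, ?_, ?_⟩
  · have : ¬ z₄ (thirds p a b c d q) ≤ 0 := by simp only [z₄, thirds]; linarith
    simp only [Coords.f, Matrix.cons_val, f₂, if_neg this]
    ext <;> simp only [Coords.add, thirds] <;> push_cast <;> ring
  · have : 0 ≤ z₄ (thirds p a b (c - 2) (d + 1) q) := by
      simp only [z₄, thirds]; push_cast; linarith
    simp only [Coords.e, Matrix.cons_val, e₂, if_pos this]
    ext <;> simp only [Coords.add, thirds] <;> push_cast <;> ring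
  · simp only [phiQ, Matrix.cons_val, thirds]
    push_cast
    rw [max_eq_left (by linarith), max_eq_left (by linarith)]; ring
  · simp only [epsQ, Matrix.cons_val, thirds]
    push_cast
    rw [max_eq_right (by linarith), max_eq_right (by linarith)]; ring

theorem arrow_one_left (h : Mem l (thirds p a b c d q))
    (h' : Mem l (thirds (p - 1) (a + 3) b c d q)) (hba : b ≤ a) (hda : d - c ≤ a - b) :
    Arrow l 1 (thirds p a b c d q) (thirds (p - 1) (a + 3) b c d q) := by
  have hba : (b : ℚ) ≤ a := by exact_mod_cast hba
  have hda : (d : ℚ) - c ≤ a - b := by exact_mod_cast hda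
  refine ⟨h, h', ?_, ?_, ?_, ?_⟩
  · have : max (z₂ (thirds p a b c d q)) 0 ≤ - z₃ (thirds p a b c d q) := by
      simp only [z₂, z₃, thirds, max_le_iff]; constructor <;> linarith
    simp only [Coords.f, Matrix.cons_val, f₁, if_pos this]
    ext <;> simp only [Coords.add, thirds] <;> push_cast <;> ring
  · have h1 : ¬ max (-z₃ (thirds (p - 1) (a + 3) b c d q)) 0
        ≤ z₂ (thirds (p - 1) (a + 3) b c d q) := by
      simp only [z₂, z₃, thirds, max_le_iff]; push_cast; intro h; linarith [h.1]
    have h2 : ¬ (z₂ (thirds (p - 1) (a + 3) b c d q) < 0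
        ∧ 0 ≤ z₃ (thirds (p - 1) (a + 3) b c d q)) := by
      simp only [z₂, z₃, thirds]; push_cast; intro h; linarith [h.2]
    simp only [Coords.e, Matrix.cons_val, e₁, if_neg h1, if_neg h2]
    ext <;> simp only [Coords.add, thirds] <;> push_cast <;> ring
  · simp only [phiQ, Matrix.cons_val, thirds]
    push_cast
    rcases le_total ((d : ℚ) / 3 - c / 3) 0 with h0 | h0
    · rw [max_eq_right h0, max_eq_right (by linarith), max_eq_right (by linarith)]; ring
    · rw [max_eq_left h0, max_eq_right (by linarith), max_eq_right (by linarith)]; ring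
  · simp only [epsQ, Matrix.cons_val, thirds]
    push_cast
    rw [max_eq_left (b := (0 : ℚ)) (a := (a : ℚ) / 3 - b / 3) (by linarith),
      max_eq_left (b := (0 : ℚ)) (a := ((a : ℚ) + 3) / 3 - b / 3) (by linarith),
      max_eq_left (by linarith), max_eq_left (by linarith)]; ring

theorem arrow_one_mid (h : Mem l (thirds p a b c d q))
    (h' : Mem l (thirds p a (b - 3) (c + 3) d q)) (hdc : d ≤ c) (hab : a + 3 ≤ b) :
    Arrow l 1 (thirds p a b c d q) (thirds p a (b - 3) (c + 3) d q) := by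
  have hdc : (d : ℚ) ≤ c := by exact_mod_cast hdc
  have hab : (a : ℚ) + 3 ≤ b := by exact_mod_cast hab
  refine ⟨h, h', ?_, ?_, ?_, ?_⟩
  · have h1 : ¬ max (z₂ (thirds p a b c d q)) 0 ≤ - z₃ (thirds p a b c d q) := by
      simp only [z₂, z₃, thirds, max_le_iff]; intro h; linarith [h.2]
    have h2 : z₂ (thirds p a b c d q) ≤ 0 ∧ 0 < z₃ (thirds p a b c d q) := by
      simp only [z₂, z₃, thirds]; constructor <;> linarith
    simp only [Coords.f, Matrix.cons_val, f₁, if_neg h1, if_pos h2]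
    ext <;> simp only [Coords.add, thirds] <;> push_cast <;> ring
  · have h1 : ¬ max (-z₃ (thirds p a (b - 3) (c + 3) d q)) 0
        ≤ z₂ (thirds p a (b - 3) (c + 3) d q) := by
      simp only [z₂, z₃, thirds, max_le_iff]; push_cast; intro h; linarith [h.2]
    have h2 : z₂ (thirds p a (b - 3) (c + 3) d q) < 0
        ∧ 0 ≤ z₃ (thirds p a (b - 3) (c + 3) d q) := by
      simp only [z₂, z₃, thirds]; push_cast; constructor <;> linarith
    simp only [Coords.e, Matrix.cons_val, e₁, if_neg h1, if_pos h2]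
    ext <;> simp only [Coords.add, thirds] <;> push_cast <;> ring
  · simp only [phiQ, Matrix.cons_val, thirds]
    push_cast
    rw [max_eq_right (b := (0 : ℚ)) (a := (d : ℚ) / 3 - c / 3) (by linarith),
      max_eq_right (b := (0 : ℚ)) (a := (d : ℚ) / 3 - (c + 3) / 3) (by linarith),
      max_eq_left (by linarith), max_eq_left (by linarith)]; ring
  · simp only [epsQ, Matrix.cons_val, thirds]
    push_cast
    rw [max_eq_right (b := (0 : ℚ)) (a := (a : ℚ) / 3 - b / 3) (by linarith),
      max_eq_right (b := (0 : ℚ)) (a := (a : ℚ) / 3 - (b - 3) / 3) (by linarith),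
      max_eq_left (by linarith), max_eq_left (by linarith)]; ring

theorem arrow_one_right (h : Mem l (thirds p a b c d q))
    (h' : Mem l (thirds p a b c (d - 3) (q + 1))) (hcd : c + 3 ≤ d) (had : a - b + 3 ≤ d - c) :
    Arrow l 1 (thirds p a b c d q) (thirds p a b c (d - 3) (q + 1)) := by
  have hcd : (c : ℚ) + 3 ≤ d := by exact_mod_cast hcd
  have had : (a : ℚ) - b + 3 ≤ d - c := by exact_mod_cast had
  refine ⟨h, h', ?_, ?_, ?_, ?_⟩
  · have h1 : ¬ max (z₂ (thirds p a b c d q)) 0 ≤ - z₃ (thirds p a b c d q) := by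
      simp only [z₂, z₃, thirds, max_le_iff]; intro h; linarith [h.1]
    have h2 : ¬ (z₂ (thirds p a b c d q) ≤ 0 ∧ 0 < z₃ (thirds p a b c d q)) := by
      simp only [z₂, z₃, thirds]; intro h; linarith [h.1]
    simp only [Coords.f, Matrix.cons_val, f₁, if_neg h1, if_neg h2]
    ext <;> simp only [Coords.add, thirds] <;> push_cast <;> ring
  · have h1 : max (-z₃ (thirds p a b c (d - 3) (q + 1))) 0
        ≤ z₂ (thirds p a b c (d - 3) (q + 1)) := by
      simp only [z₂, z₃, thirds, max_le_iff]; push_cast; constructor <;> linarith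
    simp only [Coords.e, Matrix.cons_val, e₁, if_pos h1]
    ext <;> simp only [Coords.add, thirds] <;> push_cast <;> ring
  · simp only [phiQ, Matrix.cons_val, thirds]
    push_cast
    rw [max_eq_left (b := (0 : ℚ)) (a := (d : ℚ) / 3 - c / 3) (by linarith),
      max_eq_left (b := (0 : ℚ)) (a := ((d : ℚ) - 3) / 3 - c / 3) (by linarith),
      max_eq_left (by linarith), max_eq_left (by linarith)]; ring
  · simp only [epsQ, Matrix.cons_val, thirds]
    push_cast
    rcases le_total ((a : ℚ) / 3 - b / 3) 0 with h0 | h0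
    · rw [max_eq_right h0, max_eq_right (by linarith), max_eq_right (by linarith)]; ring
    · rw [max_eq_left h0, max_eq_right (by linarith), max_eq_right (by linarith)]; ring

end ClassicalArrows

/-! ### The arrows of colour 0 -/

/-- The elements `(m, 0, 0, 0, 0, 0)` for `m ≥ 0` and `(0, 0, 0, 0, 0, -m)` for `m ≤ 0`: the
`0`-string of `B_l` through its extremal elements. -/
def axis (m : ℤ) : Coords := thirds (max m 0) 0 0 0 0 (max (-m) 0)

theorem mem_axis {l : ℕ} {m : ℤ} (h : -l ≤ m) (h' : m ≤ l) : Mem l (axis m) := by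
  apply mem_thirds <;> omega

theorem axis_of_nonneg {m : ℤ} (h : 0 ≤ m) : axis m = thirds m 0 0 0 0 0 := by
  simp [axis, h]

theorem axis_of_nonpos {m : ℤ} (h : m ≤ 0) : axis m = thirds 0 0 0 0 0 (-m) := by
  simp [axis, h]

theorem phiQ_axis (l : ℕ) (m : ℤ) : phiQ l 0 (axis m) = l - m := by
  rcases le_total m 0 with h | h
  all_goals
    have hQ := (Int.cast_le (R := ℚ)).2 h
    push_cast at hQ
    simp [phiQ, maxA, axis, thirds, z₁, z₂, z₃, z₄, s, hQ]
  rw [max_eq_right (by linarith)]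
  ring

theorem epsQ_axis (l : ℕ) (m : ℤ) : epsQ l 0 (axis m) = l + m := by
  have h := phiQ_axis l m
  have h' : z₁ (axis m) = -m := by
    rcases le_total m 0 with h | h <;> simp [axis, thirds, z₁, h]
  simp only [phiQ, Matrix.cons_val] at h
  simp only [epsQ, Matrix.cons_val, h, h']
  simp [axis, thirds, z₂, z₃, z₄]
  ring

theorem arrow_axis {l : ℕ} {m : ℤ} (h : -l ≤ m) (h' : m < l) :
    Arrow l 0 (axis m) (axis (m + 1)) := by
  refine ⟨mem_axis h h'.le, mem_axis (by omega) (by omega), ?_, ?_, ?_, ?_⟩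
  · rcases le_or_gt 0 m with h0 | h0
    · have hQ : (0 : ℚ) ≤ m := by exact_mod_cast h0
      rw [axis_of_nonneg h0, axis_of_nonneg (by omega)]
      simp [Coords.f, f₀, F₁, thirds, z₁, z₂, z₃, z₄, Coords.add, hQ]
    · have hQ : ¬ (0 : ℚ) ≤ m := by exact_mod_cast h0.not_ge
      rw [axis_of_nonpos h0.le, axis_of_nonpos (by omega)]
      simp [Coords.f, f₀, F₁, F₂, F₃, F₄, F₅, F₆, thirds, z₁, z₂, z₃, z₄, Coords.add, hQ,
        not_le.1 hQ]
      ring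
  · rcases le_or_gt 0 m with h0 | h0
    · have hQ : (0 : ℚ) < m + 1 := by exact_mod_cast Int.lt_add_one_of_le h0
      rw [axis_of_nonneg h0, axis_of_nonneg (by omega)]
      simp [Coords.e, e₀, E₁, thirds, z₁, z₂, z₃, z₄, Coords.add, -neg_add_rev, hQ]
    · have hQ : ¬ (0 : ℚ) < m + 1 := by exact_mod_cast not_lt.2 h0
      rw [axis_of_nonpos h0.le, axis_of_nonpos (by omega)]
      simp [Coords.e, e₀, E₁, E₂, E₃, E₄, E₅, E₆, thirds, z₁, z₂, z₃, z₄, Coords.add,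
        -neg_add_rev, hQ, not_lt.1 hQ]
      ring
  · simp only [phiQ_axis]; push_cast; ring
  · simp only [epsQ_axis]; push_cast; ring

theorem arrow_zero_x₂ : Arrow 1 0 (thirds 0 0 0 6 0 0) (thirds 0 3 0 0 0 0) := by
  refine ⟨?_, ?_, ?_, ?_, ?_, ?_⟩
  · apply mem_thirds <;> norm_num
  · apply mem_thirds <;> norm_num
  · norm_num [Coords.f, f₀, F₁, F₂, F₃, F₄, thirds, z₁, z₂, z₃, z₄, Coords.add]
  · norm_num [Coords.e, e₀, E₁, E₂, E₃, E₄, thirds, z₁, z₂, z₃, z₄, Coords.add]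
  · norm_num [phiQ, maxA, thirds, z₁, z₂, z₃, z₄, s]
  · norm_num [epsQ, maxA, thirds, z₁, z₂, z₃, z₄, s]

/-! ### Arrows in tensor products, and their effect on the energy -/

theorem coords_injective {l m : ℕ} {X Y : ((B l).tensor (B m)).carrier}
    (h₁ : X.1.1 = Y.1.1) (h₂ : X.2.1 = Y.2.1) : X = Y :=
  Prod.ext (Subtype.ext h₁) (Subtype.ext h₂)

/-- An arrow `x → f̃_i x = x'` of `B_l ⊗ B_m`, for pairs of coordinates. The Boolean is `true` if
the operators `f̃_i` at `x` and `ẽ_i` at `x'` act on the left factor, and `false` if both act on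
the right factor. The inequalities are those for `f̃_i` at `x`; the ones for `ẽ_i` at `x'`
follow, since `φ_i` and `ε_i` change by one along an arrow. -/
inductive TensorArrow (l m : ℕ) (i : Fin 3) : Bool → Coords × Coords → Coords × Coords → Prop
  | left {b b' c : Coords} (h : Arrow l i b b') (hc : Mem m c)
      (hle : epsQ m i c + 1 ≤ phiQ l i b) : TensorArrow l m i true (b, c) (b', c)
  | right {b c c' : Coords} (h : Arrow m i c c') (hb : Mem l b)
      (hle : phiQ l i b ≤ epsQ m i c) : TensorArrow l m i false (b, c) (b, c')

theorem le_of_cast_le {l m : ℕ} {i : Fin 3} {b : (B l).carrier} {c : (B m).carrier} {k : ℤ}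
    (h : epsQ m i c.1 + k ≤ phiQ l i b.1) : (B m).eps i c + k ≤ (B l).phi i b := by
  rw [← B_eps_cast, ← B_phi_cast] at h
  exact_mod_cast h

theorem cast_le_of_le {l m : ℕ} {i : Fin 3} {b : (B l).carrier} {c : (B m).carrier} {k : ℤ}
    (h : phiQ l i b.1 + k ≤ epsQ m i c.1) : (B l).phi i b + k ≤ (B m).eps i c := by
  rw [← B_eps_cast, ← B_phi_cast] at h
  exact_mod_cast h

theorem Arrow.f_some {l : ℕ} {i : Fin 3} {b b' : Coords} (h : Arrow l i b b') :
    (B l).f i ⟨b, h.mem_source⟩ = some ⟨b', h.mem_target⟩ := by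
  have h' := h.mem_target
  obtain ⟨-, -, rfl, -, -, -⟩ := h
  simp only [B, dif_pos h']

theorem Arrow.e_some {l : ℕ} {i : Fin 3} {b b' : Coords} (h : Arrow l i b b') :
    (B l).e i ⟨b', h.mem_target⟩ = some ⟨b, h.mem_source⟩ := by
  have h' := h.mem_source
  obtain ⟨-, -, -, rfl, -, -⟩ := h
  simp only [B, dif_pos h']

theorem TensorArrow.exists_carrier {l m : ℕ} {i : Fin 3} {s : Bool} {x x' : Coords × Coords}
    (h : TensorArrow l m i s x x') :
    ∃ X X' : ((B l).tensor (B m)).carrier, (X.1.1, X.2.1) = x ∧ (X'.1.1, X'.2.1) = x' ∧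
      ((B l).tensor (B m)).f i X = some X' ∧ ((B l).tensor (B m)).e i X' = some X ∧
      (s = true ↔ (B m).eps i X'.2 ≤ (B l).phi i X'.1) := by
  cases h with
  | @left b b' c h hc hle =>
    refine ⟨(⟨b, h.mem_source⟩, ⟨c, hc⟩), (⟨b', h.mem_target⟩, ⟨c, hc⟩), rfl, rfl, ?_⟩
    have h1 : (B m).eps i ⟨c, hc⟩ + 1 ≤ (B l).phi i ⟨b, h.mem_source⟩ :=
      le_of_cast_le (by push_cast; exact hle)
    have h2 : (B m).eps i ⟨c, hc⟩ + 0 ≤ (B l).phi i ⟨b', h.mem_target⟩ :=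
      le_of_cast_le (by have := h.phi_target; push_cast; linarith)
    rw [add_zero] at h2
    refine ⟨?_, ?_, by simpa using h2⟩
    · simp only [CrystalData.tensor, if_pos (Int.lt_of_add_one_le h1), h.f_some]; rfl
    · simp only [CrystalData.tensor, if_pos h2, h.e_some]; rfl
  | @right b c c' h hb hle =>
    refine ⟨(⟨b, hb⟩, ⟨c, h.mem_source⟩), (⟨b, hb⟩, ⟨c', h.mem_target⟩), rfl, rfl, ?_⟩
    have h1 : (B l).phi i ⟨b, hb⟩ + 0 ≤ (B m).eps i ⟨c, h.mem_source⟩ :=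
      cast_le_of_le (by push_cast; linarith)
    have h2 : (B l).phi i ⟨b, hb⟩ + 1 ≤ (B m).eps i ⟨c', h.mem_target⟩ :=
      cast_le_of_le (by have := h.eps_target; push_cast; linarith)
    rw [add_zero] at h1
    have h2' := Int.lt_of_add_one_le h2
    refine ⟨?_, ?_, by simpa using h2'⟩
    · simp only [CrystalData.tensor, if_neg (not_lt.2 h1), h.f_some]; rfl
    · simp only [CrystalData.tensor, if_neg (not_le.2 h2'), h.e_some]; rfl

/-- The amount by which the energy grows under `ẽ_i`, when `ẽ_i` acts on the side `s` of
`b ⊗ b'` and on the side `t` of `R (b ⊗ b')` (`true` for the left side). -/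
def energyStep (i : Fin 3) (s t : Bool) : ℤ :=
  if i = 0 ∧ s = true ∧ t = true then 1 else if i = 0 ∧ s = false ∧ t = false then -1 else 0

/-- `H` is an energy function with respect to the crystal isomorphism `R`. -/
def IsEnergyPair (l : ℕ) (R : Option ((B l).tensor (B 1)).carrier →
    Option ((B 1).tensor (B l)).carrier) (H : ((B l).tensor (B 1)).carrier → ℤ) : Prop :=
  IsCrystalIso ((B l).tensor (B 1)) ((B 1).tensor (B l)) R ∧
    ∀ (i : Fin 3) (b : (B l).carrier) (b' : (B 1).carrier) (c' : (B 1).carrier)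
      (c : (B l).carrier) (x : ((B l).tensor (B 1)).carrier),
      ((B l).tensor (B 1)).e i (b, b') = some x → R (some (b, b')) = some (c', c) →
      H x =
        if i = 0 ∧ (B l).phi 0 b ≥ (B 1).eps 0 b' ∧ (B 1).phi 0 c' ≥ (B l).eps 0 c
        then H (b, b') + 1
        else if i = 0 ∧ (B l).phi 0 b < (B 1).eps 0 b' ∧ (B 1).phi 0 c' < (B l).eps 0 c
        then H (b, b') - 1
        else H (b, b')

variable {l : ℕ} {R : Option ((B l).tensor (B 1)).carrier → Option ((B 1).tensor (B l)).carrier}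
  {H : ((B l).tensor (B 1)).carrier → ℤ}

/-- `R (b ⊗ b') = c' ⊗ c` and `H (b ⊗ b') = h`, where `x = (b, b')` and `y = (c', c)` are given by
their coordinates. -/
def Link (R : Option ((B l).tensor (B 1)).carrier → Option ((B 1).tensor (B l)).carrier)
    (H : ((B l).tensor (B 1)).carrier → ℤ) (x y : Coords × Coords) (h : ℤ) : Prop :=
  ∃ (X : ((B l).tensor (B 1)).carrier) (Y : ((B 1).tensor (B l)).carrier),
    (X.1.1, X.2.1) = x ∧ (Y.1.1, Y.2.1) = y ∧ R (some X) = some Y ∧ H X = h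

theorem IsEnergyPair.energy_eq (hR : IsEnergyPair l R H) {i : Fin 3} {s t : Bool}
    {X X' : ((B l).tensor (B 1)).carrier} {Y' : ((B 1).tensor (B l)).carrier}
    (hRX' : R (some X') = some Y') (he : ((B l).tensor (B 1)).e i X' = some X)
    (hs : s = true ↔ (B 1).eps i X'.2 ≤ (B l).phi i X'.1)
    (ht : t = true ↔ (B l).eps i Y'.2 ≤ (B 1).phi i Y'.1) :
    H X = H X' + energyStep i s t := by
  obtain ⟨b, b'⟩ := X'
  rw [hR.2 i b b' Y'.1 Y'.2 X he hRX']
  by_cases hi : i = 0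
  · subst hi
    simp only [energyStep, ge_iff_le, ← hs, ← ht, ← not_le]
    cases s <;> cases t <;> simp [sub_eq_add_neg]
  · simp [energyStep, hi]

theorem IsEnergyPair.exists_arrow (hR : IsEnergyPair l R H) {i : Fin 3}
    {X X' : ((B l).tensor (B 1)).carrier} {Y : ((B 1).tensor (B l)).carrier}
    (hRX : R (some X) = some Y) (hf : ((B l).tensor (B 1)).f i X = some X') :
    ∃ Y', R (some X') = some Y' ∧ ((B 1).tensor (B l)).f i Y = some Y' ∧
      ((B 1).tensor (B l)).e i Y' = some Y := by
  cases hY' : R (some X') with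
  | none => exact absurd (hR.1.bijective.1 (hY'.trans hR.1.map_zero.symm)) (by simp)
  | some Y' => exact ⟨Y', rfl, hR.1.map_arrow X X' Y Y' hRX hY' i hf⟩

theorem Link.f (hR : IsEnergyPair l R H) {x y x' y' : Coords × Coords} {h : ℤ} {i : Fin 3}
    {s t : Bool} (hxy : Link R H x y h) (hx : TensorArrow l 1 i s x x')
    (hy : TensorArrow 1 l i t y y') : Link R H x' y' (h - energyStep i s t) := by
  obtain ⟨X, Y, hX, hY, hRX, rfl⟩ := hxy
  obtain ⟨X₁, X', hX₁, hX', hf, he, hs⟩ := hx.exists_carrier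
  obtain ⟨Y₁, Y', hY₁, hY', hf', he', ht⟩ := hy.exists_carrier
  obtain rfl : X = X₁ := by
    have := hX.trans hX₁.symm
    exact coords_injective (congrArg Prod.fst this) (congrArg Prod.snd this)
  obtain rfl : Y = Y₁ := by
    have := hY.trans hY₁.symm
    exact coords_injective (congrArg Prod.fst this) (congrArg Prod.snd this)
  obtain ⟨Y'', hRX', hf'', -⟩ := hR.exists_arrow hRX hf
  obtain rfl : Y' = Y'' := Option.some.inj (hf'.symm.trans hf'')
  exact ⟨X', Y', hX', hY', hRX', by rw [hR.energy_eq hRX' he hs ht]; ring⟩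

theorem Link.e (hR : IsEnergyPair l R H) {x y x' y' : Coords × Coords} {h : ℤ} {i : Fin 3}
    {s t : Bool} (hxy : Link R H x' y' h) (hx : TensorArrow l 1 i s x x')
    (hy : TensorArrow 1 l i t y y') : Link R H x y (h + energyStep i s t) := by
  obtain ⟨X', Y', hX', hY', hRX', rfl⟩ := hxy
  obtain ⟨X, X₁, hX, hX₁, hf, he, hs⟩ := hx.exists_carrier
  obtain ⟨Y, Y₁, hY, hY₁, hf', he', ht⟩ := hy.exists_carrier
  obtain rfl : X' = X₁ := by
    have := hX'.trans hX₁.symm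
    exact coords_injective (congrArg Prod.fst this) (congrArg Prod.snd this)
  obtain rfl : Y' = Y₁ := by
    have := hY'.trans hY₁.symm
    exact coords_injective (congrArg Prod.fst this) (congrArg Prod.snd this)
  cases hRX : R (some X) with
  | none => exact absurd (hR.1.bijective.1 (hRX.trans hR.1.map_zero.symm)) (by simp)
  | some Z =>
    obtain rfl : Z = Y := by
      have := (hR.1.map_arrow X X' Z Y' hRX hRX' i hf).2
      exact Option.some.inj (this.symm.trans he')
    exact ⟨X, Z, hX, hY, hRX, hR.energy_eq hRX' he hs ht⟩

/-- Along arrows of colour 1 or 2 the energy does not change. -/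
theorem Link.e_classical (hR : IsEnergyPair l R H) {x y x' y' : Coords × Coords} {h : ℤ}
    {i : Fin 3} (hi : i ≠ 0) {s t : Bool} (hxy : Link R H x' y' h)
    (hx : TensorArrow l 1 i s x x') (hy : TensorArrow 1 l i t y y') : Link R H x y h := by
  simpa [energyStep, hi] using hxy.e hR hx hy

theorem Link.eq_energy {b : (B l).carrier} {b' : (B 1).carrier} {y : Coords × Coords} {h : ℤ}
    (hx : Link R H (b.1, b'.1) y h) : H (b, b') = h := by
  obtain ⟨X, Y, hX, -, -, rfl⟩ := hx
  congr 1
  exact coords_injective (congrArg Prod.fst hX).symm (congrArg Prod.snd hX).symm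

/-! ### The `0`-string through `u_l ⊗ u_1` -/

theorem wt_zero_cast (b : (B l).carrier) :
    ((B l).wt b 0 : ℚ) = 2 * b.1.z₁ + b.1.z₂ + b.1.z₃ + 3 * b.1.z₄ := by
  have h₁ := B_phi_cast 0 b
  have h₂ := B_eps_cast 0 b
  have h : (B l).wt b 0 = (B l).phi 0 b - (B l).eps 0 b := rfl
  rw [h, Int.cast_sub, h₁, h₂]
  simp only [phiQ, epsQ, Matrix.cons_val]
  ring

/-- The coefficient `⟨h₀, wt b⟩` is at least `-2l` on `B_l`, and `axis l` is the only element
attaining this value. -/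
theorem wt_zero_bound (b : (B l).carrier) :
    -(2 * l : ℤ) ≤ (B l).wt b 0 ∧ ((B l).wt b 0 = -(2 * l : ℤ) → b.1 = axis l) := by
  obtain ⟨p, x, y, z, w, q, hb, hp, hx, hy, hz, hw, hq, -, -, -, hs⟩ := exists_thirds b.2
  have h : 6 * (B l).wt b 0 = 12 * q - 12 * p + 2 * w - 2 * x + z - y := by
    have := wt_zero_cast b
    rw [hb] at this
    simp only [thirds, z₁, z₂, z₃, z₄] at this
    have h6 : 6 * ((B l).wt b 0 : ℚ) = 12 * q - 12 * p + 2 * w - 2 * x + z - y := by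
      rw [this]; ring
    exact_mod_cast h6
  refine ⟨by omega, fun h' => ?_⟩
  obtain rfl : x = 0 := by omega
  obtain rfl : y = 0 := by omega
  obtain rfl : z = 0 := by omega
  obtain rfl : w = 0 := by omega
  obtain rfl : q = 0 := by omega
  obtain rfl : p = l := by omega
  rw [hb, axis_of_nonneg (by omega)]

/-- `u_l ⊗ u_1` and `u_1 ⊗ u_l` are the only vectors with `⟨h₀, wt⟩ = -2 (l + 1)`. -/
theorem IsEnergyPair.link_top (hR : IsEnergyPair l R H)
    (h0 : H (u l le_rfl, u 1 le_rfl) = 0) :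
    Link R H (axis l, axis 1) (axis 1, axis l) 0 := by
  have hu : ∀ n : ℕ, (u n le_rfl : (B n).carrier).1 = axis n := fun n => by
    ext <;> simp [u, axis, thirds]
  cases hY : R (some (u l le_rfl, u 1 le_rfl)) with
  | none => exact absurd (hR.1.bijective.1 (hY.trans hR.1.map_zero.symm)) (by simp)
  | some Y =>
    have hwt : (B 1).wt Y.1 0 + (B l).wt Y.2 0
        = (B l).wt (u l le_rfl) 0 + (B 1).wt (u 1 le_rfl) 0 :=
      congrFun (hR.1.map_wt _ _ hY) 0
    have hwtu : ∀ n : ℕ, (B n).wt (u n le_rfl) 0 = -(2 * n : ℤ) := fun n => by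
      have := wt_zero_cast (u n le_rfl : (B n).carrier)
      rw [hu n, axis_of_nonneg (by omega)] at this
      simp [thirds, z₁, z₂, z₃, z₄] at this
      have h' : ((B n).wt (u n le_rfl) 0 : ℚ) = ((-(2 * n) : ℤ) : ℚ) := by
        rw [this]; push_cast; ring
      exact_mod_cast h'
    rw [hwtu, hwtu] at hwt
    have h1 := wt_zero_bound Y.1
    have h2 := wt_zero_bound Y.2
    refine ⟨_, Y, Prod.ext (hu l) (by simpa using hu 1), Prod.ext ?_ ?_, hY, h0⟩
    · exact h1.2 (by omega)
    · exact h2.2 (by omega)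

/-- A `0`-arrow of `B_l ⊗ B_m` between axis elements, acting on the left. -/
theorem tensorArrow_axis_left {l m : ℕ} {j : ℤ} {c : Coords} (hc : Mem m c) (h : -l ≤ j)
    (h' : j < l) (hle : epsQ m 0 c + 1 ≤ l - j) :
    TensorArrow l m 0 true (axis j, c) (axis (j + 1), c) :=
  .left (arrow_axis h h') hc (by rwa [phiQ_axis])

/-- A `0`-arrow of `B_l ⊗ B_m` between axis elements, acting on the right. -/
theorem tensorArrow_axis_right {l m : ℕ} {j k : ℤ} (hj : -l ≤ j) (hj' : j ≤ l) (h : -m ≤ k)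
    (h' : k < m) (hle : l - j ≤ m + k) :
    TensorArrow l m 0 false (axis j, axis k) (axis j, axis (k + 1)) :=
  .right (arrow_axis h h') (mem_axis hj hj') (by
    rw [phiQ_axis, epsQ_axis]
    exact_mod_cast hle)

theorem tensorArrow_axis_axis {l m : ℕ} {j k : ℤ} (hj : -l ≤ j) (hj' : j < l) (h : -m ≤ k)
    (h' : k ≤ m) (hle : m + k + 1 ≤ l - j) :
    TensorArrow l m 0 true (axis j, axis k) (axis (j + 1), axis k) :=
  tensorArrow_axis_left (mem_axis h h') hj hj' (by
    rw [epsQ_axis]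
    exact_mod_cast hle)

/-- `ẽ_0` acts on the right factor both of `u_l ⊗ u_1` and of its image, so the energy drops. -/
theorem IsEnergyPair.link_zero (hR : IsEnergyPair l R H) (hl : 1 ≤ l)
    (h0 : H (u l le_rfl, u 1 le_rfl) = 0) :
    Link R H (axis l, axis 0) (axis 1, axis (l - 1)) (-1) := by
  have h := hR.link_top h0
  refine h.e hR (tensorArrow_axis_right (k := 0) ?_ ?_ ?_ ?_ ?_) (t := false) ?_
  any_goals omega
  have := tensorArrow_axis_right (l := 1) (m := l) (j := 1) (k := l - 1) (by simp) (by simp)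
    (by omega) (by omega) (by push_cast; omega)
  simpa using this

/-- The first `ẽ_0` acts on the right factor of `u_l ⊗ axis 0`, the following ones on the left
factor; on the image all of them act on the right factor. So the energy drops once. -/
theorem IsEnergyPair.link_neg (hR : IsEnergyPair l R H) (hl : 1 ≤ l)
    (h0 : H (u l le_rfl, u 1 le_rfl) = 0) (k : ℕ) (hk : k + 2 ≤ 2 * l) :
    Link R H (axis (l - k), axis (-1)) (axis 1, axis (l - 2 - k)) (-2) := by
  induction k with
  | zero =>
    have h := hR.link_zero hl h0
    rw [Nat.cast_zero, sub_zero, sub_zero]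
    refine h.e hR (tensorArrow_axis_right (k := -1) ?_ ?_ ?_ ?_ ?_) (t := false) ?_
    any_goals omega
    have := tensorArrow_axis_right (l := 1) (m := l) (j := 1) (k := l - 2) (by simp) (by simp)
      (by omega) (by omega) (by push_cast; omega)
    rwa [show (l - 2 + 1 : ℤ) = l - 1 by ring] at this
  | succ k ih =>
    have hL := tensorArrow_axis_axis (l := l) (m := 1) (j := l - (k + 1 : ℕ)) (k := -1) (by omega)
      (by omega) (by simp) (by simp) (by push_cast; omega)
    have hR' := tensorArrow_axis_right (l := 1) (m := l) (j := 1) (k := l - 2 - (k + 1 : ℕ))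
      (by simp) (by simp) (by omega) (by omega) (by push_cast; omega)
    rw [show (l - (k + 1 : ℕ) + 1 : ℤ) = l - k by push_cast; ring] at hL
    rw [show (l - 2 - (k + 1 : ℕ) + 1 : ℤ) = l - 2 - k by push_cast; ring] at hR'
    exact (ih (by omega)).e hR hL hR'

/-- `ε_0` vanishes at `axis (-l)`, so the last `ẽ_0` acts on the left factor of the image too, and
the energy grows. -/
theorem IsEnergyPair.link_bottom (hR : IsEnergyPair l R H) (hl : 1 ≤ l)
    (h0 : H (u l le_rfl, u 1 le_rfl) = 0) :
    Link R H (axis (1 - l), axis (-1)) (axis 0, axis (-l)) (-1) := by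
  have h := hR.link_neg hl h0 (2 * l - 2) (by omega)
  rw [show (l - (2 * l - 2 : ℕ) : ℤ) = 1 - l + 1 by omega,
    show (l - 2 - (2 * l - 2 : ℕ) : ℤ) = - l by omega] at h
  exact h.e hR (tensorArrow_axis_axis (by omega) (by omega) (by simp) (by simp)
    (by push_cast; omega)) (tensorArrow_axis_axis (j := 0) (by simp) (by simp) (by omega) (by omega)
      (by push_cast; omega))

/-! ### Extremal strings of colours 1 and 2 -/

/-- A family `F n 0 ← F n 1 ← ⋯ ← F n (N n)` of complete `i`-strings, the `n`-th of which lies in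
`B_l` for all `l ≥ n`. -/
structure IsString (i : Fin 3) (N : ℕ) (F : ℕ → ℕ → Coords) : Prop where
  mem : ∀ {l n k : ℕ}, n ≤ l → k ≤ N * n → Mem l (F n k)
  arrow : ∀ {l n k : ℕ}, n ≤ l → k < N * n → Arrow l i (F n (k + 1)) (F n k)
  phi : ∀ {l n k : ℕ}, k ≤ N * n → phiQ l i (F n k) = k
  eps : ∀ {l n k : ℕ}, k ≤ N * n → epsQ l i (F n k) = N * n - k

theorem phiQ_axis_zero {i : Fin 3} (hi : i ≠ 0) : phiQ l i (axis 0) = 0 := by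
  fin_cases i
  · exact absurd rfl hi
  all_goals simp [phiQ, axis, thirds]

theorem epsQ_nonneg {i : Fin 3} {b : Coords} (hb : Mem l b) : 0 ≤ epsQ l i b := by
  obtain ⟨-, -, -, -, ⟨m, hm⟩, ⟨n, hn⟩, -, hs, -⟩ := hb
  have hm' : (0 : ℚ) ≤ m := by positivity
  have hn' : (0 : ℚ) ≤ n := by positivity
  fin_cases i
  · have : 2 * b.z₁ + b.z₂ + b.z₃ + 3 * b.z₄ ≤ b.maxA := by simp [maxA]
    simp only [epsQ, Fin.zero_eta, Matrix.cons_val]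
    linarith
  · have := le_max_right (b.y₃ - b.y₂ + max (b.x₂ - b.x₃) 0) 0
    simp only [epsQ, Fin.mk_one, Matrix.cons_val]
    linarith
  · have := le_max_right (b.x₃ - b.y₃) 0
    simp only [epsQ, Fin.reduceFinMk, Matrix.cons_val]
    linarith

theorem phiQ_nonneg {i : Fin 3} {b : Coords} (hb : Mem l b) : 0 ≤ phiQ l i b := by
  obtain ⟨⟨n, hn⟩, ⟨m, hm⟩, -, -, -, -, -, hs, -⟩ := hb
  have hm' : (0 : ℚ) ≤ m := by positivity
  have hn' : (0 : ℚ) ≤ n := by positivity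
  fin_cases i
  · have : 0 ≤ b.maxA := by simp [maxA]
    simp only [phiQ, Fin.zero_eta, Matrix.cons_val]
    linarith
  · have := le_max_right (b.x₃ - b.x₂ + max (b.y₂ - b.y₃) 0) 0
    simp only [phiQ, Fin.mk_one, Matrix.cons_val]
    linarith
  · have := le_max_right (b.y₃ - b.x₃) 0
    simp only [phiQ, Fin.reduceFinMk, Matrix.cons_val]
    linarith

/-- Since `φ_i` vanishes at `axis 0` for `i ≠ 0`, all classical arrows of `axis 0 ⊗ B_m` are those
of `B_m`. -/
theorem Arrow.tensor_axis_zero {m : ℕ} {i : Fin 3} (hi : i ≠ 0) {c c' : Coords}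
    (h : Arrow m i c c') : TensorArrow l m i false (axis 0, c) (axis 0, c') :=
  .right h (mem_axis (by omega) (by omega))
    (by rw [phiQ_axis_zero hi]; exact epsQ_nonneg h.mem_source)

/-- Raising the lowest element of a string to its highest one, first in the right factor and then
in the left one. -/
theorem IsString.link {i : Fin 3} {N n : ℕ} {F : ℕ → ℕ → Coords} (hF : IsString i N F)
    (hi : i ≠ 0) (hl : l = n + 1) (hR : IsEnergyPair l R H) {e : ℤ}
    (h : Link R H (F n 0, F 1 0) (axis 0, F l 0) e) :
    Link R H (F n (N * n), F 1 (N * 1)) (axis 0, F l (N * l)) e := by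
  have h₁ : ∀ k ≤ N, Link R H (F n 0, F 1 k) (axis 0, F l k) e := by
    intro k hk
    induction k with
    | zero => exact h
    | succ k ih =>
      refine (ih (by omega)).e_classical hR hi
        (.right (hF.arrow le_rfl (by omega)) (hF.mem (by omega) (by omega)) ?_)
        ((hF.arrow le_rfl (by rw [hl, mul_add]; omega)).tensor_axis_zero hi)
      rw [hF.phi (by omega), Nat.cast_zero]
      exact epsQ_nonneg (hF.mem le_rfl (by omega))
  have h₂ : ∀ k ≤ N * n, Link R H (F n k, F 1 N) (axis 0, F l (N + k)) e := by
    intro k hk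
    induction k with
    | zero => exact h₁ N le_rfl
    | succ k ih =>
      refine (ih (by omega)).e_classical hR hi
        (.left (hF.arrow (by omega) (by omega)) (hF.mem le_rfl (by omega)) ?_)
        ((hF.arrow (k := N + k) le_rfl (by rw [hl, mul_add]; omega)).tensor_axis_zero hi)
      rw [hF.phi (by omega), hF.eps (by omega)]
      push_cast
      have : (0 : ℚ) ≤ k := by positivity
      linarith
  have h₃ := h₂ (N * n) le_rfl
  rwa [show N + N * n = N * l by rw [hl]; ring, ← congrArg (F 1) (mul_one N)] at h₃

/-- The `1`-strings from `(0, 0, 0, 0, 0, n)` up to `(0, 0, 0, 0, n, 0)`. -/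
def stringToY₂ (n k : ℕ) : Coords := thirds 0 0 0 0 (3 * k) (n - k)

/-- The `2`-strings from `(0, 0, 0, 0, n, 0)` up to `(0, 0, 0, 2n, 0, 0)`. -/
def stringToY₃ (n k : ℕ) : Coords := thirds 0 0 0 (2 * k) (3 * n - k) 0

/-- The `1`-strings from `(0, 0, 0, 2n, 0, 0)` up to `(0, 0, 2n, 0, 0, 0)`. -/
def stringToX₃ (n k : ℕ) : Coords := thirds 0 0 (3 * k) (6 * n - 3 * k) 0 0

/-- The `2`-strings from `(0, 0, 2n, 0, 0, 0)` up to `(0, n, 0, 0, 0, 0)`. -/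
def stringToX₂ (n k : ℕ) : Coords := thirds 0 k (6 * n - 2 * k) 0 0 0

/-- The `1`-strings from `(0, n, 0, 0, 0, 0)` up to `(n, 0, 0, 0, 0, 0)`. -/
def stringToX₁ (n k : ℕ) : Coords := thirds k (3 * (n - k)) 0 0 0 0

theorem isStringToY₂ : IsString 1 1 stringToY₂ := by
  have mem : ∀ {l n k : ℕ}, n ≤ l → k ≤ 1 * n → Mem l (stringToY₂ n k) := by
    intro l n k _ _
    apply mem_thirds <;> omega
  refine ⟨mem, ?_, ?_, ?_⟩
  · intro l n k h h'
    have hs : stringToY₂ n k = thirds 0 0 0 0 (3 * (k + 1 : ℕ) - 3) (n - (k + 1 : ℕ) + 1) := by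
      unfold stringToY₂; congr 1 <;> omega
    have h₀ := mem h h'.le
    rw [hs] at h₀ ⊢
    exact arrow_one_right (mem h h') h₀ (by omega) (by omega)
  · intro l n k h
    simp [phiQ, stringToY₂, thirds]
  · intro l n k h
    simp [epsQ, stringToY₂, thirds]

theorem isStringToY₃ : IsString 2 3 stringToY₃ := by
  have mem : ∀ {l n k : ℕ}, n ≤ l → k ≤ 3 * n → Mem l (stringToY₃ n k) := by
    intro l n k _ _
    apply mem_thirds <;> omega
  refine ⟨mem, ?_, ?_, ?_⟩
  · intro l n k h h'
    have hs : stringToY₃ n k = thirds 0 0 0 (2 * (k + 1 : ℕ) - 2) (3 * n - (k + 1 : ℕ) + 1) 0 := by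
      unfold stringToY₃; congr 1 <;> omega
    have h₀ := mem h h'.le
    rw [hs] at h₀ ⊢
    exact arrow_two_right (mem h h') h₀ (by omega)
  · intro l n k h
    simp [phiQ, stringToY₃, thirds]
    rw [max_eq_left (by positivity)]; ring
  · intro l n k h
    simp [epsQ, stringToY₃, thirds]
    rw [max_eq_right (by simp; positivity)]; ring

theorem isStringToX₃ : IsString 1 2 stringToX₃ := by
  have mem : ∀ {l n k : ℕ}, n ≤ l → k ≤ 2 * n → Mem l (stringToX₃ n k) := by
    intro l n k _ _
    apply mem_thirds <;> omega
  refine ⟨mem, ?_, ?_, ?_⟩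
  · intro l n k h h'
    have hs : stringToX₃ n k =
        thirds 0 0 (3 * (k + 1 : ℕ) - 3) (6 * n - 3 * (k + 1 : ℕ) + 3) 0 0 := by
      unfold stringToX₃; congr 1 <;> omega
    have h₀ := mem h h'.le
    rw [hs] at h₀ ⊢
    exact arrow_one_mid (mem h h') h₀ (by omega) (by omega)
  · intro l n k h
    have h' : (k : ℚ) ≤ 2 * n := by exact_mod_cast h
    have h0 : (0 : ℚ) ≤ k := by positivity
    simp only [phiQ, Matrix.cons_val, stringToX₃, thirds]
    push_cast
    rw [max_eq_right (b := (0 : ℚ)) (a := 0 / 3 - _) (by linarith), max_eq_left (by linarith)]; ring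
  · intro l n k h
    have h' : (k : ℚ) ≤ 2 * n := by exact_mod_cast h
    have h0 : (0 : ℚ) ≤ k := by positivity
    simp only [epsQ, Matrix.cons_val, stringToX₃, thirds]
    push_cast
    rw [max_eq_right (b := (0 : ℚ)) (a := 0 / 3 - _) (by linarith), max_eq_left (by linarith)]; ring

theorem isStringToX₂ : IsString 2 3 stringToX₂ := by
  have mem : ∀ {l n k : ℕ}, n ≤ l → k ≤ 3 * n → Mem l (stringToX₂ n k) := by
    intro l n k _ _
    apply mem_thirds <;> omega
  refine ⟨mem, ?_, ?_, ?_⟩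
  · intro l n k h h'
    have hs : stringToX₂ n k = thirds 0 ((k + 1 : ℕ) - 1) (6 * n - 2 * (k + 1 : ℕ) + 2) 0 0 0 := by
      unfold stringToX₂; congr 1 <;> omega
    have h₀ := mem h h'.le
    rw [hs] at h₀ ⊢
    exact arrow_two_left (mem h h') h₀ (by omega)
  all_goals
    intro l n k h
    have h' : (k : ℚ) ≤ 3 * n := by exact_mod_cast h
    simp only [phiQ, epsQ, Matrix.cons_val, stringToX₂, thirds]
    push_cast
  · rw [max_eq_right (by linarith)]; ring
  · rw [max_eq_left (by linarith)]; ring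

theorem isStringToX₁ : IsString 1 1 stringToX₁ := by
  have mem : ∀ {l n k : ℕ}, n ≤ l → k ≤ 1 * n → Mem l (stringToX₁ n k) := by
    intro l n k _ _
    apply mem_thirds <;> omega
  refine ⟨mem, ?_, ?_, ?_⟩
  · intro l n k h h'
    have hs : stringToX₁ n k = thirds ((k + 1 : ℕ) - 1) (3 * (n - (k + 1 : ℕ)) + 3) 0 0 0 0 := by
      unfold stringToX₁; congr 1 <;> omega
    have h₀ := mem h h'.le
    rw [hs] at h₀ ⊢
    exact arrow_one_left (mem h h') h₀ (by omega) (by omega)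
  all_goals
    intro l n k h
    have h' : (k : ℚ) ≤ n := by exact_mod_cast (one_mul n ▸ h)
    simp only [phiQ, epsQ, Matrix.cons_val, stringToX₁, thirds]
    push_cast
    norm_num [h']

theorem stringToY₂_zero (n : ℕ) : stringToY₂ n 0 = axis (-n) := by
  rw [axis_of_nonpos (by omega)]; unfold stringToY₂; congr 1; omega

theorem stringToY₂_last (n : ℕ) : stringToY₂ n (1 * n) = stringToY₃ n 0 := by
  unfold stringToY₂ stringToY₃; congr 1 <;> omega

theorem stringToY₃_last (n : ℕ) : stringToY₃ n (3 * n) = stringToX₃ n 0 := by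
  unfold stringToY₃ stringToX₃; congr 1 <;> omega

theorem stringToX₃_last (n : ℕ) : stringToX₃ n (2 * n) = stringToX₂ n 0 := by
  unfold stringToX₃ stringToX₂; congr 1 <;> omega

theorem stringToX₂_last (n : ℕ) : stringToX₂ n (3 * n) = stringToX₁ n 0 := by
  unfold stringToX₂ stringToX₁; congr 1; all_goals omega

theorem stringToX₁_last (n : ℕ) : stringToX₁ n (1 * n) = axis n := by
  rw [axis_of_nonneg (by omega)]; unfold stringToX₁; congr 1 <;> omega

/-- `u_{l-1} ⊗ u_1` is the highest weight vector of the classical component whose lowest weight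
vector is `axis (1 - l) ⊗ axis (-1)`. -/
theorem IsEnergyPair.link_one (hR : IsEnergyPair l R H) (hl : 1 ≤ l)
    (h0 : H (u l le_rfl, u 1 le_rfl) = 0) :
    Link R H (axis (l - 1), axis 1) (axis 0, axis l) (-1) := by
  obtain ⟨n, rfl⟩ := Nat.exists_eq_add_of_le' hl
  have h := hR.link_bottom hl h0
  have key : Link R H (stringToY₂ n 0, stringToY₂ 1 0) (axis 0, stringToY₂ (n + 1) 0) (-1) := by
    simp only [stringToY₂_zero]
    rwa [show (-n : ℤ) = 1 - (n + 1 : ℕ) by push_cast; ring]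
  have h₁ := isStringToY₂.link (by decide) rfl hR key
  rw [stringToY₂_last, stringToY₂_last, stringToY₂_last] at h₁
  have h₂ := isStringToY₃.link (by decide) rfl hR h₁
  rw [stringToY₃_last, stringToY₃_last, stringToY₃_last] at h₂
  have h₃ := isStringToX₃.link (by decide) rfl hR h₂
  rw [stringToX₃_last, stringToX₃_last, stringToX₃_last] at h₃
  have h₄ := isStringToX₂.link (by decide) rfl hR h₃
  rw [stringToX₂_last, stringToX₂_last, stringToX₂_last] at h₄
  have h₅ := isStringToX₁.link (by decide) rfl hR h₄
  rw [stringToX₁_last, stringToX₁_last, stringToX₁_last] at h₅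
  simpa using h₅

/-- For `j < l`, the vectors `u_j ⊗ axis 0` are linked by `0`-arrows to `u_{l-1} ⊗ u_1`. -/
theorem IsEnergyPair.link_axis_zero (hR : IsEnergyPair l R H)
    (h0 : H (u l le_rfl, u 1 le_rfl) = 0) (k : ℕ) {j : ℕ} (hj : j + k + 1 = l) :
    Link R H (axis j, axis 0) (axis 0, axis j) (-2) := by
  induction k generalizing j with
  | zero =>
    have h := hR.link_one (by omega) h0
    rw [show (l - 1 : ℤ) = j by omega, show (l : ℤ) = j + 1 by omega] at h
    exact h.e hR (tensorArrow_axis_right (k := 0) (by omega) (by omega) (by simp) (by simp)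
      (by push_cast; omega)) (tensorArrow_axis_right (by simp) (by simp) (by omega) (by omega)
        (by push_cast; omega))
  | succ k ih =>
    have h := ih (j := j + 1) (by omega)
    rw [Nat.cast_succ] at h
    exact h.e hR (tensorArrow_axis_axis (by omega) (by omega) (by simp) (by simp)
      (by push_cast; omega)) (tensorArrow_axis_right (by simp) (by simp) (by omega) (by omega)
        (by push_cast; omega))

/-! ### The classical component of `axis 0 ⊗ axis (-1)` -/

/-- The classical operators do not see the coordinate `x̄₁`, so that a classical arrow of `B_1` can
be shifted into `B_l` by adding `axis (-1)` to both ends. -/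
theorem Arrow.shift {i : Fin 3} (hi : i ≠ 0) (hl : 2 ≤ l) {b b' : Coords} (h : Arrow 1 i b b') :
    Arrow l i (b.add (axis (-1))) (b'.add (axis (-1))) := by
  have mem : ∀ {x}, Mem 1 x → Mem l (x.add (axis (-1))) := by
    intro x hx
    obtain ⟨p, a, b, c, d, q, rfl, hp, ha, hb, hc, hd, hq, h1, h2, h3, hs⟩ := exists_thirds hx
    have : (thirds p a b c d q).add (axis (-1)) = thirds p a b c d (q + 1) := by
      ext <;> simp [Coords.add, thirds, axis]
    rw [this]
    apply mem_thirds <;> first | assumption | omega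
  have hz : ∀ x : Coords, (x.add (axis (-1))).z₂ = x.z₂ ∧ (x.add (axis (-1))).z₃ = x.z₃ ∧
      (x.add (axis (-1))).z₄ = x.z₄ := by
    intro x
    simp [Coords.add, axis, thirds, z₂, z₃, z₄]
  have hcomm : ∀ x d : Coords, (x.add (axis (-1))).add d = (x.add d).add (axis (-1)) := by
    intro x d
    ext <;> simp only [Coords.add] <;> ring
  refine ⟨mem h.mem_source, mem h.mem_target, ?_, ?_, ?_, ?_⟩
  · rw [← h.f_eq]
    obtain ⟨h₂, h₃, h₄⟩ := hz b
    fin_cases i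
    · exact absurd rfl hi
    · simp only [Coords.f, Fin.mk_one, Matrix.cons_val, f₁, h₂, h₃, hcomm]
      split_ifs <;> rfl
    · simp only [Coords.f, Fin.reduceFinMk, Matrix.cons_val, f₂, h₄, hcomm]
      split_ifs <;> rfl
  · rw [← h.e_eq]
    obtain ⟨h₂, h₃, h₄⟩ := hz b'
    fin_cases i
    · exact absurd rfl hi
    · simp only [Coords.e, Fin.mk_one, Matrix.cons_val, e₁, h₂, h₃, hcomm]
      split_ifs <;> rfl
    · simp only [Coords.e, Fin.reduceFinMk, Matrix.cons_val, e₂, h₄, hcomm]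
      split_ifs <;> rfl
  · have := h.phi_target
    fin_cases i
    · exact absurd rfl hi
    all_goals
      simp [phiQ, Coords.add, axis, thirds] at this ⊢
      linarith
  · have := h.eps_target
    fin_cases i
    · exact absurd rfl hi
    all_goals
      simp [epsQ, Coords.add, axis, thirds] at this ⊢
      linarith

/-- The link of `axis 0 ⊗ b'` for `b'` in the classical component of `axis (-1)` in `B_1`. Its
image under `R` depends on whether `l = 1`. -/
def LinkedAtZero (R : Option ((B l).tensor (B 1)).carrier → Option ((B 1).tensor (B l)).carrier)
    (H : ((B l).tensor (B 1)).carrier → ℤ) (b' : Coords) : Prop :=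
  (l = 1 → Link R H (axis 0, b') (axis 0, b') (-1)) ∧
    (2 ≤ l → Link R H (axis 0, b') (axis 1, b'.add (axis (-1))) (-2))

theorem IsEnergyPair.linkedAtZero_lowest (hR : IsEnergyPair l R H)
    (h0 : H (u l le_rfl, u 1 le_rfl) = 0) : LinkedAtZero R H (axis (-1)) := by
  refine ⟨fun hl => ?_, fun hl => ?_⟩
  · have h := hR.link_bottom hl.ge h0
    rwa [show (1 - l : ℤ) = 0 by omega, show (-l : ℤ) = -1 by omega] at h
  · have h := hR.link_neg (by omega) h0 l (by omega)
    have : (axis (-1)).add (axis (-1)) = axis (-2) := by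
      ext <;> norm_num [Coords.add, axis, thirds]
    rwa [sub_self, show (l - 2 - l : ℤ) = -2 by ring, ← this] at h

theorem LinkedAtZero.e (hR : IsEnergyPair l R H) {i : Fin 3} (hi : i ≠ 0) {b b' : Coords}
    (h : LinkedAtZero R H b') (hb : Arrow 1 i b b') : LinkedAtZero R H b := by
  refine ⟨fun hl => ?_, fun hl => ?_⟩
  · subst hl
    exact (h.1 rfl).e_classical hR hi (hb.tensor_axis_zero hi) (hb.tensor_axis_zero hi)
  · refine (h.2 hl).e_classical hR hi (hb.tensor_axis_zero hi)
      (.right (hb.shift hi hl) (mem_axis (by simp) (by simp)) ?_)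
    -- `φ_1 (u_1) = 1` is compensated by `x̄₁ ≥ 1` on the right factor.
    have := epsQ_nonneg (i := i) hb.mem_source
    fin_cases i
    · exact absurd rfl hi
    · simp [phiQ, epsQ, axis, thirds, Coords.add] at this ⊢
      linarith
    · simp [phiQ, epsQ, axis, thirds, Coords.add] at this ⊢
      linarith

theorem LinkedAtZero.string (hR : IsEnergyPair l R H) {i : Fin 3} (hi : i ≠ 0) {N : ℕ}
    {F : ℕ → ℕ → Coords} (hF : IsString i N F) (h : LinkedAtZero R H (F 1 0)) {k : ℕ}
    (hk : k ≤ N) : LinkedAtZero R H (F 1 k) := by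
  induction k with
  | zero => exact h
  | succ k ih => exact (ih (by omega)).e hR hi (hF.arrow le_rfl (by omega))

theorem IsEnergyPair.linkedAtZero (hR : IsEnergyPair l R H)
    (h0 : H (u l le_rfl, u 1 le_rfl) = 0) :
    LinkedAtZero R H (thirds 0 0 0 6 0 0) ∧ LinkedAtZero R H (thirds 0 0 3 3 0 0) ∧
      LinkedAtZero R H (thirds 0 3 0 0 0 0) ∧ LinkedAtZero R H (axis 1) ∧
      LinkedAtZero R H (thirds 0 1 1 3 0 0) := by
  have h := hR.linkedAtZero_lowest h0
  have s₁ : LinkedAtZero R H (stringToY₂ 1 0) := by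
    rw [stringToY₂_zero]; exact h
  have s₁' : LinkedAtZero R H (stringToY₃ 1 0) := by
    rw [← stringToY₂_last]; exact s₁.string hR (by decide) isStringToY₂ le_rfl
  have s₂ : LinkedAtZero R H (stringToX₃ 1 0) := by
    rw [← stringToY₃_last]; exact s₁'.string hR (by decide) isStringToY₃ le_rfl
  have s₃ : LinkedAtZero R H (stringToX₂ 1 0) := by
    rw [← stringToX₃_last]; exact s₂.string hR (by decide) isStringToX₃ le_rfl
  have s₄ : LinkedAtZero R H (stringToX₁ 1 0) := by
    rw [← stringToX₂_last]; exact s₃.string hR (by decide) isStringToX₂ le_rfl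
  refine ⟨s₂, s₂.string hR (by decide) isStringToX₃ (k := 1) (by norm_num), s₄, ?_, ?_⟩
  · have := s₄.string hR (by decide) isStringToX₁ le_rfl
    rwa [show stringToX₁ 1 1 = axis 1 from stringToX₁_last 1] at this
  · have t₀ : LinkedAtZero R H (thirds 0 0 0 4 1 0) :=
      s₁'.string hR (by decide) isStringToY₃ (k := 2) (by norm_num)
    have mem : Mem 1 (thirds 0 0 0 4 1 0) ∧ Mem 1 (thirds 0 0 3 1 1 0) ∧
        Mem 1 (thirds 0 1 1 1 1 0) ∧ Mem 1 (thirds 0 1 1 3 0 0) := by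
      refine ⟨?_, ?_, ?_, ?_⟩ <;> apply mem_thirds <;> norm_num
    have t₁ : LinkedAtZero R H (thirds 0 0 3 1 1 0) :=
      t₀.e hR (by decide) (arrow_one_mid mem.2.1 mem.1 (by norm_num) (by norm_num))
    have t₂ : LinkedAtZero R H (thirds 0 1 1 1 1 0) :=
      t₁.e hR (by decide) (arrow_two_left mem.2.2.1 mem.2.1 (by norm_num))
    exact t₂.e hR (by decide) (arrow_two_right mem.2.2.2 mem.2.2.1 (by norm_num))

/-! ### Raising the left factor -/

theorem coe_eq_of_e_eq_some {i : Fin 3} {b d : (B l).carrier} (h : (B l).e i b = some d) :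
    d.1 = Coords.e i b.1 := by
  simp only [B] at h
  split_ifs at h
  exact (congrArg Subtype.val (Option.some.inj h)).symm

/-- `φ_0 (u_1) = 0`, so that `f̃_0` acts on the right factor of every `u_1 ⊗ c`. -/
theorem Link.f_zero (hR : IsEnergyPair l R H) {x x' : Coords × Coords} {h : ℤ} {s : Bool}
    (hx : ∃ c, Link R H x (axis 1, c) h) (hs : TensorArrow l 1 0 s x x') :
    ∃ c, Link R H x' (axis 1, c) (h - energyStep 0 s false) := by
  obtain ⟨c, X, Y, hX, hY, hRX, rfl⟩ := hx
  obtain ⟨X₁, X', hX₁, hX', hf, he, hs⟩ := hs.exists_carrier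
  obtain rfl : X = X₁ := by
    have := hX.trans hX₁.symm
    exact coords_injective (congrArg Prod.fst this) (congrArg Prod.snd this)
  obtain ⟨Y', hRX', hf', he'⟩ := hR.exists_arrow hRX hf
  have hY₁ : Y.1.1 = axis 1 := congrArg Prod.fst hY
  have hphi : (B 1).phi 0 Y.1 = 0 := by
    have := B_phi_cast 0 Y.1
    rw [hY₁, phiQ_axis] at this
    simpa using this
  have heps : ¬ (B l).eps 0 Y.2 < (B 1).phi 0 Y.1 := by
    have := epsQ_nonneg (i := 0) Y.2.2
    rw [← B_eps_cast 0 Y.2] at this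
    rw [hphi, not_lt]
    exact_mod_cast this
  have hY'₁ : Y'.1 = Y.1 := by
    have hf : ((B l).f 0 Y.2).map (fun c => (Y.1, c)) = some Y' := by
      simpa only [CrystalData.tensor, if_neg heps] using hf'
    obtain ⟨c', -, hc'⟩ := Option.map_eq_some_iff.1 hf
    exact (congrArg Prod.fst hc').symm
  refine ⟨Y'.2.1, X', Y', hX', by rw [hY'₁, hY₁], hRX', ?_⟩
  rw [hR.energy_eq hRX' he hs (t := false)]
  · ring
  -- If `ẽ_0` acted on the left of `u_1 ⊗ c'`, it would change that factor.
  · simp only [Bool.false_eq_true, false_iff]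
    intro hle
    have he : ((B 1).e 0 Y'.1).map (fun c => (c, Y'.2)) = some Y := by
      simpa only [CrystalData.tensor, if_pos hle] using he'
    obtain ⟨d, hd, hdY⟩ := Option.map_eq_some_iff.1 he
    have hdY : d = Y.1 := congrArg Prod.fst hdY
    rw [hY'₁, hdY] at hd
    have h₁ := coe_eq_of_e_eq_some hd
    have h₂ : Coords.e 0 (axis 1) = axis 0 :=
      (arrow_axis (l := 1) (m := 0) (by simp) (by simp)).e_eq
    rw [hY₁, h₂] at h₁
    have := congrArg Coords.x₁ h₁
    simp [axis, thirds] at this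

/-- For `l ≥ 2`, each `f̃_0` acts on the left factor of `axis j ⊗ b'` and on the right factor of the
image, as long as `φ_0` of the left factor is large enough. -/
theorem LinkedAtZero.raise_of_two_le (hR : IsEnergyPair l R H) {b' : Coords}
    (h : LinkedAtZero R H b') (hb' : Mem 1 b') (hl : 2 ≤ l) {j : ℕ}
    (hj : epsQ 1 0 b' + j ≤ l) : ∃ c, Link R H (axis j, b') (axis 1, c) (-2) := by
  induction j with
  | zero => exact ⟨_, h.2 hl⟩
  | succ j ih =>
    have heps := epsQ_nonneg (i := 0) hb'
    push_cast at hj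
    have hlt : j < l := by
      have : (j : ℚ) + 1 ≤ l := by linarith
      exact_mod_cast this
    rw [Nat.cast_succ]
    exact Link.f_zero hR (ih (by linarith)) (tensorArrow_axis_left hb' (by omega) (by omega)
      (by push_cast; linarith))

/-- If `ε_0` vanishes at `b'`, the left factor can be raised up to `u_l`. For `l = 1` the single
step acts on the left factor of the image `0 ⊗ b'` as well, and lowers the energy from `-1`
to `-2`. -/
theorem LinkedAtZero.raise (hR : IsEnergyPair l R H) {b' : Coords} (h : LinkedAtZero R H b')
    (hb' : Mem 1 b') (hl : 1 ≤ l) (heps : epsQ 1 0 b' = 0) {j : ℕ} (hj : 1 ≤ j) (hjl : j ≤ l) :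
    ∃ c, Link R H (axis j, b') (axis 1, c) (-2) := by
  rcases hl.eq_or_lt with rfl | hl
  · obtain rfl : j = 1 := by omega
    have hs : TensorArrow 1 1 0 true (axis 0, b') (axis (0 + 1), b') :=
      tensorArrow_axis_left hb' (by simp) (by simp) (by simp [heps])
    exact ⟨_, (h.1 rfl).f hR hs hs⟩
  · exact h.raise_of_two_le hR hb' hl (by rw [heps, zero_add]; exact_mod_cast hjl)

/-- The values of `ε_0` at those highest weight elements of `B_1` that are not of the form
`axis m`. -/
theorem epsQ_zero_values : epsQ 1 0 (thirds 0 0 0 6 0 0) = 0 ∧ epsQ 1 0 (thirds 0 0 3 3 0 0) = 0 ∧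
    epsQ 1 0 (thirds 0 1 1 3 0 0) = 0 ∧ epsQ 1 0 (thirds 0 3 0 0 0 0) = 1 := by
  refine ⟨?_, ?_, ?_, ?_⟩ <;> norm_num [epsQ, maxA, thirds, z₁, z₂, z₃, z₄, s]

/-! ### Highest weight vectors -/

theorem e_one_ne_none {b : (B l).carrier} (h : 0 < epsQ l 1 b.1) : (B l).e 1 b ≠ none := by
  obtain ⟨x, hx⟩ := b
  obtain ⟨p, a, b, c, d, q, rfl, hp, ha, hb, hc, hd, hq, hab, hcd, hbc, hs⟩ := exists_thirds hx
  suffices hm : Mem l (Coords.e 1 (thirds p a b c d q)) by simp [B, hm]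
  simp only [Coords.e, Matrix.cons_val, e₁]
  split_ifs with h₁ h₂
  · have hz : 0 ≤ d - c ∧ b - a + (d - c) ≥ 0 := by
      simp only [thirds, z₂, z₃, max_le_iff] at h₁
      have h₁' : (0 : ℚ) ≤ d - c ∧ (b : ℚ) - a + (d - c) ≥ 0 := by constructor <;> linarith
      exact_mod_cast h₁'
    have hq : 1 ≤ q := by
      have hz₁ : (0 : ℚ) ≤ d - c := by exact_mod_cast hz.1
      have hz₂ : (b : ℚ) - a + (d - c) ≥ 0 := by exact_mod_cast hz.2
      have hmax : max ((c : ℚ) / 3 - d / 3 + max ((a : ℚ) / 3 - b / 3) 0) 0 = 0 := by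
        rcases le_total ((a : ℚ) / 3 - b / 3) 0 with h0 | h0
        · rw [max_eq_right h0, max_eq_right (by linarith)]
        · rw [max_eq_left h0, max_eq_right (by linarith)]
      simp only [epsQ, Matrix.cons_val, thirds, hmax, add_zero] at h
      exact Int.cast_pos.1 h
    have : (thirds p a b c d q).add ⟨0, 0, 0, 0, 1, -1⟩ = thirds p a b c (d + 3) (q - 1) := by
      ext <;> simp only [Coords.add, thirds] <;> push_cast <;> ring
    rw [this]
    apply mem_thirds <;> omega
  · have hz : d < c := by
      simp only [thirds, z₂, z₃] at h₂
      have : (d : ℚ) < c := by linarith [h₂.1]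
      exact_mod_cast this
    have : (thirds p a b c d q).add ⟨0, 0, 1, -1, 0, 0⟩ = thirds p a (b + 3) (c - 3) d q := by
      ext <;> simp only [Coords.add, thirds] <;> push_cast <;> ring
    rw [this]
    apply mem_thirds <;> omega
  · have hz : b < a := by
      by_contra hba
      have hba : (a : ℚ) ≤ b := by exact_mod_cast not_lt.1 hba
      simp only [thirds, z₂, z₃, max_le_iff, not_and, not_le] at h₁ h₂
      by_cases hdc : (d : ℚ) / 3 - c / 3 < 0
      · linarith [h₂ hdc]
      · linarith [h₁ (by linarith)]
    have : (thirds p a b c d q).add ⟨1, -1, 0, 0, 0, 0⟩ = thirds (p + 1) (a - 3) b c d q := by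
      ext <;> simp only [Coords.add, thirds] <;> push_cast <;> ring
    rw [this]
    apply mem_thirds <;> omega

theorem e_two_ne_none {b : (B l).carrier} (h : 0 < epsQ l 2 b.1) : (B l).e 2 b ≠ none := by
  obtain ⟨x, hx⟩ := b
  obtain ⟨p, a, b, c, d, q, rfl, hp, ha, hb, hc, hd, hq, hab, hcd, hbc, hs⟩ := exists_thirds hx
  suffices hm : Mem l (Coords.e 2 (thirds p a b c d q)) by simp [B, hm]
  simp only [Coords.e, Matrix.cons_val, e₂]
  split_ifs with h₁
  · have hz : (b : ℚ) ≤ c := by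
      simp only [thirds, z₄] at h₁
      linarith
    have hd : 1 ≤ d := by
      simp only [epsQ, Matrix.cons_val, thirds] at h
      rw [max_eq_right (by linarith)] at h
      have : (0 : ℚ) < d := by linarith
      exact_mod_cast this
    have : (thirds p a b c d q).add ⟨0, 0, 0, 2 / 3, -1 / 3, 0⟩
        = thirds p a b (c + 2) (d - 1) q := by
      ext <;> simp only [Coords.add, thirds] <;> push_cast <;> ring
    rw [this]
    apply mem_thirds <;> omega
  · have hz : c < b := by
      simp only [thirds, z₄] at h₁
      have : (c : ℚ) < b := by linarith
      exact_mod_cast this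
    have : (thirds p a b c d q).add ⟨0, 1 / 3, -2 / 3, 0, 0, 0⟩
        = thirds p (a + 1) (b - 2) c d q := by
      ext <;> simp only [Coords.add, thirds] <;> push_cast <;> ring
    rw [this]
    apply mem_thirds <;> omega

/-- The signature rule: if `ẽ_i` kills `b ⊗ c`, then it kills `b`, and `ε_i c ≤ φ_i b`. The
hypothesis says that `ε_i` detects whether `ẽ_i` acts as zero. -/
theorem eps_of_tensor_e_eq_none {m : ℕ} {i : Fin 3}
    (hreg : ∀ {n : ℕ} {b : (B n).carrier}, 0 < epsQ n i b.1 → (B n).e i b ≠ none)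
    {b : (B l).carrier} {c : (B m).carrier} (h : ((B l).tensor (B m)).e i (b, c) = none) :
    epsQ l i b.1 = 0 ∧ epsQ m i c.1 ≤ phiQ l i b.1 := by
  by_cases hle : (B m).eps i c ≤ (B l).phi i b
  · simp only [CrystalData.tensor, if_pos hle, Option.map_eq_none_iff] at h
    refine ⟨le_antisymm (not_lt.1 fun h' => hreg h' h) (epsQ_nonneg b.2), ?_⟩
    rw [← B_eps_cast, ← B_phi_cast]
    exact_mod_cast hle
  · simp only [CrystalData.tensor, if_neg hle, Option.map_eq_none_iff] at h
    have hlt : phiQ l i b.1 < epsQ m i c.1 := by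
      rw [← B_eps_cast, ← B_phi_cast]
      exact_mod_cast not_le.1 hle
    exact absurd h (hreg ((phiQ_nonneg b.2).trans_lt hlt))

theorem eq_axis_of_eps_eq_zero {b : Coords} (hb : Mem l b) (h₁ : epsQ l 1 b = 0)
    (h₂ : epsQ l 2 b = 0) : ∃ j : ℕ, j ≤ l ∧ b = axis j := by
  obtain ⟨p, x, y, z, w, q, rfl, hp, hx, hy, hz, hw, hq, -, -, -, hs⟩ := exists_thirds hb
  have hwQ : (0 : ℚ) ≤ w := by exact_mod_cast hw
  have hqQ : (0 : ℚ) ≤ q := by exact_mod_cast hq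
  simp only [epsQ, Matrix.cons_val, thirds] at h₁ h₂
  have m₁ := le_max_left ((y : ℚ) / 3 - z / 3) 0
  have m₂ := le_max_right ((y : ℚ) / 3 - z / 3) 0
  have m₃ := le_max_left ((z : ℚ) / 3 - w / 3 + max ((x : ℚ) / 3 - y / 3) 0) 0
  have m₄ := le_max_right ((z : ℚ) / 3 - w / 3 + max ((x : ℚ) / 3 - y / 3) 0) 0
  have m₅ := le_max_left ((x : ℚ) / 3 - y / 3) 0
  have m₆ := le_max_right ((x : ℚ) / 3 - y / 3) 0
  have k₁ : (w : ℚ) ≤ 0 := by linarith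
  have k₂ : (q : ℚ) ≤ 0 := by linarith
  have k₃ : (z : ℚ) ≤ w := by linarith
  have k₄ : (y : ℚ) ≤ z := by linarith
  have k₅ : (z : ℚ) + x ≤ w + y := by linarith
  norm_cast at k₁ k₂ k₃ k₄ k₅
  obtain rfl : w = 0 := by omega
  obtain rfl : q = 0 := by omega
  obtain rfl : z = 0 := by omega
  obtain rfl : y = 0 := by omega
  obtain rfl : x = 0 := by omega
  refine ⟨p.toNat, by omega, ?_⟩
  rw [axis_of_nonneg (by omega), Int.toNat_of_nonneg hp]

/-- The highest weight vectors of `B_l ⊗ B_1` for colours 1 and 2. -/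
theorem highestWeight_cases {b : (B l).carrier} {b' : (B 1).carrier}
    (hw : IsHighestWeight ((B l).tensor (B 1)) (b, b')) :
    ∃ j : ℕ, j ≤ l ∧ b.1 = axis j ∧ (b'.1 = axis 1 ∨ b'.1 = axis 0 ∨ 1 ≤ j ∧
      (b'.1 = axis (-1) ∨ b'.1 = thirds 0 3 0 0 0 0 ∨ b'.1 = thirds 0 0 3 3 0 0 ∨
        b'.1 = thirds 0 1 1 3 0 0 ∨ b'.1 = thirds 0 0 0 6 0 0)) := by
  obtain ⟨h₁, h₁'⟩ := eps_of_tensor_e_eq_none e_one_ne_none hw.1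
  obtain ⟨h₂, h₂'⟩ := eps_of_tensor_e_eq_none e_two_ne_none hw.2
  obtain ⟨j, hj, hb⟩ := eq_axis_of_eps_eq_zero b.2 h₁ h₂
  refine ⟨j, hj, hb, ?_⟩
  obtain ⟨p, x, y, z, w, q, hb', hp, hx, hy, hz, hw, hq, d₁, d₂, d₃, hs⟩ := exists_thirds b'.2
  rw [hb, axis_of_nonneg (by omega), hb'] at h₁' h₂'
  simp only [epsQ, phiQ, Matrix.cons_val, thirds, Int.cast_natCast, Int.cast_zero, zero_div,
    sub_self, max_self, add_zero, mul_zero] at h₁' h₂'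
  have hwQ : (0 : ℚ) ≤ w := by exact_mod_cast hw
  have m₁ := le_max_left ((y : ℚ) / 3 - z / 3) 0
  have m₂ := le_max_right ((y : ℚ) / 3 - z / 3) 0
  have m₃ := le_max_left ((z : ℚ) / 3 - w / 3 + max ((x : ℚ) / 3 - y / 3) 0) 0
  have m₄ := le_max_right ((z : ℚ) / 3 - w / 3 + max ((x : ℚ) / 3 - y / 3) 0) 0
  have m₅ := le_max_left ((x : ℚ) / 3 - y / 3) 0
  have m₆ := le_max_right ((x : ℚ) / 3 - y / 3) 0
  have k₁ : (w : ℚ) ≤ 0 := by linarith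
  have k₂ : (y : ℚ) ≤ z := by linarith
  have k₃ : 3 * (q : ℚ) + (z - w) ≤ 3 * j := by linarith
  have k₄ : 3 * (q : ℚ) + (z - w) + (x - y) ≤ 3 * j := by linarith
  have k₅ : (q : ℚ) ≤ j := by linarith
  norm_cast at k₁ k₂ k₅
  have k₃ : 3 * q + (z - w) ≤ 3 * j := by exact_mod_cast k₃
  have k₄ : 3 * q + (z - w) + (x - y) ≤ 3 * j := by exact_mod_cast k₄
  obtain rfl : w = 0 := by omega
  have cases : (p = 1 ∧ x = 0 ∧ y = 0 ∧ z = 0 ∧ q = 0) ∨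
      (p = 0 ∧ x = 0 ∧ y = 0 ∧ z = 0 ∧ q = 0) ∨ 1 ≤ j ∧
      ((p = 0 ∧ x = 0 ∧ y = 0 ∧ z = 0 ∧ q = 1) ∨ (p = 0 ∧ x = 3 ∧ y = 0 ∧ z = 0 ∧ q = 0) ∨
        (p = 0 ∧ x = 0 ∧ y = 3 ∧ z = 3 ∧ q = 0) ∨ (p = 0 ∧ x = 1 ∧ y = 1 ∧ z = 3 ∧ q = 0) ∨
        (p = 0 ∧ x = 0 ∧ y = 0 ∧ z = 6 ∧ q = 0)) := by
    have : p ≤ 1 := by omega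
    have : q ≤ 1 := by omega
    have : x ≤ 3 := by omega
    have : z = 0 ∨ z = 3 ∨ z = 6 := by omega
    rcases this with rfl | rfl | rfl <;> interval_cases p <;> interval_cases q <;>
      interval_cases x <;> omega
  rw [hb']
  rcases cases with ⟨rfl, rfl, rfl, rfl, rfl⟩ | ⟨rfl, rfl, rfl, rfl, rfl⟩ |
    ⟨hj1, ⟨rfl, rfl, rfl, rfl, rfl⟩ | ⟨rfl, rfl, rfl, rfl, rfl⟩ | ⟨rfl, rfl, rfl, rfl, rfl⟩ |
      ⟨rfl, rfl, rfl, rfl, rfl⟩ | ⟨rfl, rfl, rfl, rfl, rfl⟩⟩ <;> simp_all [axis]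

end G2Crystal

open Classical G2Crystal in
theorem theorem2 (l : ℕ) (hl : 1 ≤ l)
    (H : ((B l).tensor (B 1)).carrier → ℤ)
    (hH : IsEnergyFunction (B l) (B 1) H)
    (hnorm : H (u l le_rfl, u 1 le_rfl) = 0)
    (b : (B l).carrier) (b' : (B 1).carrier)
    (hw : IsHighestWeight ((B l).tensor (B 1)) (b, b')) :
    ∃ (j : ℕ) (hj : j ≤ l), b = u j hj ∧
      H (b, b') =
        if j = l ∧ b'.1 = ⟨1, 0, 0, 0, 0, 0⟩ then 0
        else if (j + 1 = l ∧ b'.1 = ⟨1, 0, 0, 0, 0, 0⟩) ∨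
          (j = l ∧ (b'.1 = ⟨0, 1, 0, 0, 0, 0⟩ ∨ b'.1 = ⟨0, 0, 0, 0, 0, 0⟩)) then -1
        else -2 := by
  obtain ⟨R, hR⟩ := hH
  have hR : IsEnergyPair l R H := hR
  obtain ⟨j, hj, hb, hb'⟩ := highestWeight_cases hw
  refine ⟨j, hj, Subtype.ext (by rw [hb, axis_of_nonneg (by omega)]; simp [u, thirds]), ?_⟩
  have energy : ∀ {y h}, Link R H (axis j, b'.1) y h → H (b, b') = h := fun hx => by
    rw [← hb] at hx
    exact hx.eq_energy
  obtain ⟨linkD, linkC, linkX, linkU, linkT⟩ := hR.linkedAtZero hnorm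
  obtain ⟨epsD, epsC, epsT, epsX⟩ := epsQ_zero_values
  rcases hb' with hb' | hb' | ⟨hj1, hb' | hb' | hb' | hb' | hb'⟩ <;> rw [hb'] at energy ⊢
  · rcases hj.eq_or_lt with rfl | hlt
    · rw [energy (hR.link_top hnorm)]
      simp [axis, thirds]
    rcases (show j + 1 ≤ l from hlt).eq_or_lt with hl1 | hlt
    · have h := hR.link_one hl hnorm
      rw [show (l - 1 : ℤ) = j by omega] at h
      rw [energy h]
      simp [axis, thirds, hl1]
      omega
    · obtain ⟨c, h⟩ := linkU.raise_of_two_le hR (mem_axis (by simp) (by simp)) (by omega)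
        (j := j) (by
        rw [epsQ_axis]
        have : (j : ℚ) + 2 ≤ l := by exact_mod_cast hlt
        push_cast
        linarith)
      rw [energy h]
      simp [axis, thirds]
      omega
  · rcases hj.eq_or_lt with rfl | hlt
    · rw [energy (hR.link_zero hl hnorm)]
      simp [axis, thirds]
    · rw [energy (hR.link_axis_zero hnorm (l - j - 1) (by omega))]
      simp [axis, thirds]
      omega
  · have h := hR.link_neg hl hnorm (l - j) (by omega)
    rw [show (l - (l - j : ℕ) : ℤ) = j by omega] at h
    rw [energy h]
    simp [axis, thirds]
  -- `(0, 1, 0, 0, 0, 0)` has `ε_0 = 1`, so the left factor can be raised only up to `u_{l-1}`;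
  -- `u_l` is reached through `(0, 0, 0, 2, 0, 0)`.
  · rcases hj.eq_or_lt with rfl | hlt
    · have h₁ := linkD.raise hR (by apply mem_thirds <;> norm_num) hl epsD hj1 le_rfl
      obtain ⟨c, h⟩ := Link.f_zero hR h₁ (.right arrow_zero_x₂ (mem_axis (by omega) (by omega)) (by
        rw [phiQ_axis, Int.cast_natCast, sub_self]
        exact epsQ_nonneg arrow_zero_x₂.mem_source))
      rw [energy h]
      simp [thirds, energyStep]
    · obtain ⟨c, h⟩ := linkX.raise_of_two_le hR (by apply mem_thirds <;> norm_num) (by omega)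
        (j := j)
        (by
          have : (j : ℚ) + 1 ≤ l := by exact_mod_cast hlt
          rw [epsX]
          linarith)
      rw [energy h]
      simp [thirds]
      omega
  · obtain ⟨c, h⟩ := linkC.raise hR (by apply mem_thirds <;> norm_num) hl epsC hj1 hj
    rw [energy h]
    norm_num [thirds]
  · obtain ⟨c, h⟩ := linkT.raise hR (by apply mem_thirds <;> norm_num) hl epsT hj1 hj
    rw [energy h]
    norm_num [thirds]
  · obtain ⟨c, h⟩ := linkD.raise hR (by apply mem_thirds <;> norm_num) hl epsD hj1 hj
    rw [energy h]
    norm_num [thirds]
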